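/- For $p\in(0,1)$ let $c_p\in\mathbb R$ be the unique real number with $\mathbb P[Z\le -c_p]=p$, where $Z\sim\mathcal N(0,1)$, and put $a=\frac{1}{\sqrt{2\pi}}e^{-c_p^2/2}$. Let $x_1,\dots,x_r$ be independent $\mathcal N(0,\frac1d I_d)$ vectors in $\mathbb R^d$. They form a red clique if $\langle x_i,x_j\rangle<-c_p/\sqrt d$ for all $i\ne j$, and a blue clique if $\langle x_i,x_j\rangle\ge -c_p/\sqrt d$ for all $i\neq j$. Given $C>1$ and $\ell$, put $\alpha=100\,C\log(10/p)$ and $\delta=\alpha d^{-1/4}$, and call $(x_1,\dots,x_r)$ a perfect sequence if, for every $1\le i\le r$, $\|x_i\|_2\in(1-\delta,1+\delta)$ and the orthogonal projection of $x_i$ onto $\mathrm{span}\{x_1,\dots,x_{i-1}\}$ has norm at most $\alpha\sqrt{\ell}/\sqrt{d}$. Let $P^*_{\mathrm{red},r}$ (respectively $P^*_{\mathrm{blue},r}$) be the probability that $x_1,\dots,x_r$ form a red (respectively blue) clique and a perfect sequence. For all real $C>1$ and $p\in(0,1)$ there are constants $K>0$ and $D_0>0$, depending only on $p$ and $C$,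 such that for every real $D\ge D_0$ there is $\ell_0$ such that for all integers $\ell\ge\ell_0$ for which $d=D^2\ell^2$ is an integer, and for every integer $r$ with $1\le r\le C\ell$ and $r\neq 2$, $$P^*_{\mathrm{red},r}\le p^{\binom r2}\exp\Big(-\Big(1-\frac KD\Big)\frac{a^3}{p^3\sqrt d}\binom r3\Big),\qquad P^*_{\mathrm{blue},r}\le (1-p)^{\binom r2}\exp\Big(\Big(1+\frac KD\Big)\frac{a^3}{(1-p)^3\sqrt d}\binom r3\Big),$$ while for $r=2$ (provided $2\le C\ell$) $$P^*_{\mathrm{red},2}\le p\,\exp\Big(\frac{K}{D\sqrt d}\Big),\qquad P^*_{\mathrm{blue},2}\le (1-p)\exp\Big(\frac{K}{D\sqrt d}\Big).$$ -/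

import Mathlib

open MeasureTheory ProbabilityTheory
open scoped RealInnerProductSpace

noncomputable section

/-- The threshold `c_p`: the real number `c` with `ℙ[Z ≤ -c] = p` for a standard Gaussian `Z`.
For `0 < p < 1` it exists and is unique, see `gaussThreshold_spec`, `gaussThreshold_unique`. -/
def gaussThreshold (p : ℝ) : ℝ :=
  Classical.epsilon fun c : ℝ => (gaussianReal 0 1).real (Set.Iic (-c)) = p

theorem gaussThreshold_spec {p : ℝ} (hp0 : 0 < p) (hp1 : p < 1) :
    (gaussianReal 0 1).real (Set.Iic (-gaussThreshold p)) = p := by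
  have : NullSingletonClass (gaussianReal 0 1) := nullSingletonClass_gaussianReal one_ne_zero
  have hcont : Continuous (cdf (gaussianReal 0 1)) := by
    rw [continuous_iff_continuousAt]
    intro x
    rw [(monotone_cdf _).continuousAt_iff_leftLim_eq_rightLim, StieltjesFunction.rightLim_eq]
    refine le_antisymm ((monotone_cdf _).leftLim_le le_rfl) ?_
    have h : (gaussianReal 0 1) {x} = 0 := measure_singleton x
    rw [← measure_cdf (gaussianReal 0 1), StieltjesFunction.measure_singleton,
      ENNReal.ofReal_eq_zero] at h
    linarith
  obtain ⟨x, hx⟩ : ∃ x, cdf (gaussianReal 0 1) x = p := by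
    refine mem_range_of_exists_le_of_exists_ge hcont ?_ ?_
    · exact ((tendsto_cdf_atBot (gaussianReal 0 1)).eventually (ge_mem_nhds hp0)).exists
    · exact ((tendsto_cdf_atTop (gaussianReal 0 1)).eventually (le_mem_nhds hp1)).exists
  rw [cdf_eq_real] at hx
  exact Classical.epsilon_spec
    (p := fun c : ℝ => (gaussianReal 0 1).real (Set.Iic (-c)) = p) ⟨-x, by simpa using hx⟩

theorem gaussThreshold_unique {p c : ℝ} (hp0 : 0 < p) (hp1 : p < 1)
    (hc : (gaussianReal 0 1).real (Set.Iic (-c)) = p) : c = gaussThreshold p := by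
  have key : ∀ x y : ℝ, x < y →
      (gaussianReal 0 1).real (Set.Iic x) ≠ (gaussianReal 0 1).real (Set.Iic y) := by
    intro x y hxy h
    have h1 : (gaussianReal 0 1).real (Set.Ioc x y) = 0 := by
      rw [← Set.Iic_sdiff_Iic, measureReal_sdiff (Set.Iic_subset_Iic.2 hxy.le) measurableSet_Iic, h,
        sub_self]
    have h2 : (gaussianReal 0 1) (Set.Ioc x y) = 0 := by
      rwa [measureReal_eq_zero_iff] at h1
    have h3 := gaussianReal_absolutelyContinuous' 0 (one_ne_zero (α := NNReal)) h2
    rw [Real.volume_Ioc, ENNReal.ofReal_eq_zero] at h3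
    linarith
  have hs := gaussThreshold_spec hp0 hp1
  rcases lt_trichotomy c (gaussThreshold p) with h | h | h
  · exact absurd (hs.trans hc.symm) (key _ _ (by linarith))
  · exact h
  · exact absurd (hc.trans hs.symm) (key _ _ (by linarith))

/-- `a = φ(c_p) = exp(-c_p² / 2) / √(2π)`. -/
def gaussDensityAtThreshold (p : ℝ) : ℝ :=
  Real.exp (-(gaussThreshold p) ^ 2 / 2) / √(2 * Real.pi)

/-- The joint law of `r` independent random vectors `x₁, …, x_r ∼ 𝒩(0, (1/d) I_d)` in `ℝ^d`. -/
def gaussSample (d r : ℕ) : Measure (Fin r → EuclideanSpace ℝ (Fin d)) :=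
  Measure.pi fun _ => multivariateGaussian 0 ((1 / (d : ℝ)) • (1 : Matrix (Fin d) (Fin d) ℝ))

/-- The geometric graph of the vectors `x₁, …, x_r`: distinct `i, j` are adjacent iff
`⟨x_i, x_j⟩ ≥ -c_p / √d`. Its edges are the blue edges, its non-edges the red ones. -/
def geomGraph (p : ℝ) {d r : ℕ} (x : Fin r → EuclideanSpace ℝ (Fin d)) : SimpleGraph (Fin r) where
  Adj i j := i ≠ j ∧ -gaussThreshold p / √(d : ℝ) ≤ ⟪x i, x j⟫
  symm := ⟨fun i j h => ⟨h.1.symm, by rw [real_inner_comm]; exact h.2⟩⟩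
  loopless := ⟨fun _ h => h.1 rfl⟩

/-- The vectors form a red clique: no two of them are adjacent. -/
def IsRedClique (p : ℝ) {d r : ℕ} (x : Fin r → EuclideanSpace ℝ (Fin d)) : Prop :=
  (geomGraph p x).IsIndepSet Set.univ

/-- The vectors form a blue clique: any two of them are adjacent. -/
def IsBlueClique (p : ℝ) {d r : ℕ} (x : Fin r → EuclideanSpace ℝ (Fin d)) : Prop :=
  (geomGraph p x).IsClique Set.univ

/-- `α = 100 C log (10 / p)`. -/
def perfectAlpha (C p : ℝ) : ℝ := 100 * C * Real.log (10 / p)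

/-- `δ = α d^(-1/4)`. -/
def perfectDelta (C p : ℝ) (d : ℕ) : ℝ := perfectAlpha C p * (d : ℝ) ^ (-(1 / 4) : ℝ)

/-- Perfect sequences: for every `i`, the norm of `x_i` lies in `(1 - δ, 1 + δ)` and the
orthogonal projection of `x_i` to the span of the earlier vectors has norm at most `α √ℓ / √d`. -/
def IsPerfectSeq (C p : ℝ) (ℓ : ℕ) {d r : ℕ} (x : Fin r → EuclideanSpace ℝ (Fin d)) : Prop :=
  ∀ i : Fin r,
    ‖x i‖ ∈ Set.Ioo (1 - perfectDelta C p d) (1 + perfectDelta C p d) ∧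
    ‖(Submodule.span ℝ (x '' {j | j < i})).starProjection (x i)‖ ≤
      perfectAlpha C p * √(ℓ : ℝ) / √(d : ℝ)

/-- `P*_{red, r}`: the probability that `r` independent vectors distributed as `𝒩(0, (1/d) I_d)`
form a red clique and a perfect sequence. -/
def redPerfectProb (C p : ℝ) (ℓ d r : ℕ) : ℝ :=
  (gaussSample d r).real {x | IsRedClique p x ∧ IsPerfectSeq C p ℓ x}

/-- `P*_{blue, r}`: the probability that `r` independent vectors distributed as `𝒩(0, (1/d) I_d)`
form a blue clique and a perfect sequence. -/
def bluePerfectProb (C p : ℝ) (ℓ d r : ℕ) : ℝ :=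
  (gaussSample d r).real {x | IsBlueClique p x ∧ IsPerfectSeq C p ℓ x}

end

/-!
Condition on the first `k` vectors and integrate out the next one: the clique condition confines it
to an orthant, whose Gaussian measure is bounded one half-space at a time along the Gram–Schmidt
residuals. Writing `h = φ/Φ`, log-concavity of `Φ` gives the tangent bound
`Φ y ≤ Φ t * exp (h t * (y - t))`, so every half-space costs a factor `Φ t` times an exponential
tilt. Iterating, each integrated vector adds about `(h t) ^ 2` to the coefficient of the pair sum
`∑ ⟪x i, x j⟫` of the remaining vectors in the exponent. After `n` integrations this tilt,
`n * (h t) ^ 2`, shifts the mean of the next vector, and against the `k` half-spaces the shift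
contributes `∓ n * k * (h t) ^ 3 / √d`, with the upper sign for red cliques and the lower one for
blue; over all steps `∑ n * k = r.choose 3`. Fluctuations of the norms enter only through a
quadratic potential in `‖x i‖ ^ 2 - 1`. All errors are `O(r ^ 3 / (D * √d))`, which for `r ≥ 3` is
absorbed into the main term as a relative error `K / D`.
-/

/-! ### The standard Gaussian distribution function -/

/-- The distribution function `Φ` of the standard Gaussian law. -/
noncomputable def gaussCDF (x : ℝ) : ℝ := (gaussianReal 0 1).real (Set.Iic x)

/-- The logarithmic derivative `φ / Φ` of the Gaussian distribution function, i.e. the reversed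
hazard rate of the standard Gaussian law. -/
noncomputable def gaussHazard (x : ℝ) : ℝ := gaussianPDFReal 0 1 x / gaussCDF x

section GaussCDF

lemma gaussCDF_eq_integral (x : ℝ) : gaussCDF x = ∫ t in Set.Iic x, gaussianPDFReal 0 1 t := by
  rw [gaussCDF, measureReal_def, gaussianReal_apply_eq_integral 0 one_ne_zero,
    ENNReal.toReal_ofReal (integral_nonneg fun t => gaussianPDFReal_nonneg _ _ _)]

lemma gaussCDF_pos (x : ℝ) : 0 < gaussCDF x := by
  have : (gaussianReal 0 1).IsOpenPosMeasure :=
    (gaussianReal_absolutelyContinuous' 0 one_ne_zero).isOpenPosMeasure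
  exact ENNReal.toReal_pos
    (Measure.measure_pos_of_mem_nhds _ (Iic_mem_nhds (sub_one_lt x))).ne' (measure_ne_top _ _)

lemma gaussHazard_pos (x : ℝ) : 0 < gaussHazard x :=
  div_pos (gaussianPDFReal_pos _ _ _ one_ne_zero) (gaussCDF_pos x)

lemma gaussHazard_nonneg (x : ℝ) : 0 ≤ gaussHazard x := (gaussHazard_pos x).le

lemma hasDerivAt_gaussianPDFReal (μ : ℝ) (v : NNReal) (x : ℝ) :
    HasDerivAt (gaussianPDFReal μ v) (-((x - μ) / v) * gaussianPDFReal μ v x) x := by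
  have hexponent : HasDerivAt (fun y : ℝ => -(y - μ) ^ 2 / (2 * (v : ℝ))) (-((x - μ) / v)) x := by
    refine (((((hasDerivAt_id x).sub_const μ).pow 2).neg).div_const (2 * (v : ℝ))).congr_deriv ?_
    simp only [id_eq, Nat.cast_ofNat, pow_one, Nat.add_one_sub_one, mul_one]
    rw [neg_div, mul_div_mul_left _ _ two_ne_zero]
  rw [gaussianPDFReal_def]
  exact (hexponent.exp.const_mul _).congr_deriv (by ring)

lemma continuous_gaussianPDFReal (μ : ℝ) (v : NNReal) : Continuous (gaussianPDFReal μ v) :=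
  continuous_iff_continuousAt.2 fun x => (hasDerivAt_gaussianPDFReal μ v x).continuousAt

lemma hasDerivAt_gaussCDF (x : ℝ) : HasDerivAt gaussCDF (gaussianPDFReal 0 1 x) x := by
  have hintg := integrable_gaussianPDFReal 0 1
  have hcont := continuous_gaussianPDFReal 0 1
  have hFTC : gaussCDF = fun y => (∫ t in (0 : ℝ)..y, gaussianPDFReal 0 1 t) + gaussCDF 0 := by
    funext y
    rw [gaussCDF_eq_integral, gaussCDF_eq_integral,
      ← intervalIntegral.integral_Iic_sub_Iic hintg.integrableOn hintg.integrableOn, sub_add_cancel]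
  rw [hFTC]
  exact (intervalIntegral.integral_hasDerivAt_right hintg.intervalIntegrable
    (hcont.stronglyMeasurableAtFilter _ _) hcont.continuousAt).add_const _

lemma integrable_mul_gaussianPDFReal : Integrable fun t => t * gaussianPDFReal 0 1 t := by
  refine ((integrable_mul_exp_neg_mul_sq one_half_pos).const_mul (√(2 * Real.pi))⁻¹).congr
    (ae_of_all _ fun x => ?_)
  simp only [gaussianPDFReal_def, NNReal.coe_one]
  ring_nf

lemma setIntegral_Iic_mul_gaussianPDFReal (x : ℝ) :
    ∫ t in Set.Iic x, t * gaussianPDFReal 0 1 t = -gaussianPDFReal 0 1 x := by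
  have hderiv : ∀ t ∈ Set.Iic x,
      HasDerivAt (fun t => -gaussianPDFReal 0 1 t) (t * gaussianPDFReal 0 1 t) t := fun t _ =>
    (hasDerivAt_gaussianPDFReal 0 1 t).neg.congr_deriv (by simp)
  have hintg := integrable_mul_gaussianPDFReal.integrableOn (s := Set.Iic x)
  rw [integral_Iic_of_hasDerivAt_of_tendsto' hderiv hintg
    (tendsto_zero_of_hasDerivAt_of_integrableOn_Iic hderiv hintg
      (integrable_gaussianPDFReal 0 1).neg.integrableOn), sub_zero]

/-- Mills' inequality: the left-hand side is `∫ (x - t) φ(t) dt` over `t ≤ x`. -/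
lemma mul_gaussCDF_add_gaussianPDFReal_nonneg (x : ℝ) :
    0 ≤ x * gaussCDF x + gaussianPDFReal 0 1 x := by
  rw [gaussCDF_eq_integral, ← sub_neg_eq_add, ← setIntegral_Iic_mul_gaussianPDFReal,
    ← integral_const_mul, ← integral_sub ((integrable_gaussianPDFReal 0 1).const_mul x).integrableOn
      integrable_mul_gaussianPDFReal.integrableOn]
  refine setIntegral_nonneg measurableSet_Iic fun t (ht : t ≤ x) => ?_
  rw [← sub_mul]
  exact mul_nonneg (sub_nonneg.2 ht) (gaussianPDFReal_nonneg _ _ _)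

lemma antitone_gaussHazard : Antitone gaussHazard := by
  refine antitone_of_hasDerivAt_nonpos (fun x => (hasDerivAt_gaussianPDFReal 0 1 x).div
    (hasDerivAt_gaussCDF x) (gaussCDF_pos x).ne') fun x =>
      div_nonpos_of_nonpos_of_nonneg ?_ (sq_nonneg _)
  have hMills := mul_nonneg (mul_gaussCDF_add_gaussianPDFReal_nonneg x)
    (gaussianPDFReal_nonneg 0 1 x)
  simp only [sub_zero, NNReal.coe_one, div_one]
  linarith

lemma hasDerivAt_log_gaussCDF (x : ℝ) :
    HasDerivAt (fun y => Real.log (gaussCDF y)) (gaussHazard x) x :=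
  (hasDerivAt_gaussCDF x).log (gaussCDF_pos x).ne'

lemma concaveOn_log_gaussCDF : ConcaveOn ℝ Set.univ fun x => Real.log (gaussCDF x) := by
  refine Antitone.concaveOn_univ_of_deriv
    (fun x => (hasDerivAt_log_gaussCDF x).differentiableAt) ?_
  rw [funext fun x => (hasDerivAt_log_gaussCDF x).deriv]
  exact antitone_gaussHazard

lemma le_tangent_of_concaveOn {f : ℝ → ℝ} {S : Set ℝ} {f' x y : ℝ} (hf : ConcaveOn ℝ S f)
    (hx : x ∈ S) (hy : y ∈ S) (hf' : HasDerivAt f f' x) : f y ≤ f x + f' * (y - x) := by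
  rcases lt_trichotomy x y with hxy | rfl | hyx
  · have h := hf.slope_le_of_hasDerivAt hx hy hxy hf'
    rw [slope_def_field, div_le_iff₀ (sub_pos.2 hxy)] at h
    linarith
  · simp
  · have h := hf.le_slope_of_hasDerivAt hy hx hyx hf'
    rw [slope_def_field, le_div_iff₀ (sub_pos.2 hyx)] at h
    linarith

lemma gaussCDF_le_tangent (x y : ℝ) :
    gaussCDF y ≤ gaussCDF x * Real.exp (gaussHazard x * (y - x)) := by
  rw [← Real.log_le_log_iff (gaussCDF_pos y) (mul_pos (gaussCDF_pos x) (Real.exp_pos _)),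
    Real.log_mul (gaussCDF_pos x).ne' (Real.exp_pos _).ne', Real.log_exp]
  exact le_tangent_of_concaveOn concaveOn_log_gaussCDF (Set.mem_univ x) (Set.mem_univ y)
    (hasDerivAt_log_gaussCDF x)

end GaussCDF

/-! ### The standard Gaussian measure on a Euclidean space -/

lemma lintegral_eq_ofReal_pow_mul_lintegral_comp_smul_add {E : Type*} [NormedAddCommGroup E]
    [NormedSpace ℝ E] [FiniteDimensional ℝ E] [MeasurableSpace E] [BorelSpace E] (μ : Measure E)
    [μ.IsAddHaarMeasure] {κ : ℝ} (hκ : 0 < κ) (v : E) {G : E → ENNReal} (hG : Measurable G) :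
    ∫⁻ x, G x ∂μ = ENNReal.ofReal (κ ^ Module.finrank ℝ E) * ∫⁻ x, G (κ • x + v) ∂μ := by
  have hmap : ∫⁻ x, G (κ • x + v) ∂μ =
      ENNReal.ofReal |(κ ^ Module.finrank ℝ E)⁻¹| * ∫⁻ x, G (x + v) ∂μ := by
    rw [← lintegral_map (f := fun y => G (y + v)) (g := fun x : E => κ • x) (by fun_prop)
      (by fun_prop), Measure.map_addHaar_smul μ hκ.ne', lintegral_smul_measure, smul_eq_mul]
  rw [hmap, lintegral_add_right_eq_self, ← mul_assoc, ← ENNReal.ofReal_mul (by positivity),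
    abs_of_pos (by positivity), mul_inv_cancel₀ (by positivity), ENNReal.ofReal_one, one_mul]

section StdGaussian

variable {E : Type*} [NormedAddCommGroup E] [InnerProductSpace ℝ E]

lemma norm_sq_sub_inner_smul {u : E} (hu : ‖u‖ = 1) (t : E) :
    ‖t - ⟪u, t⟫ • u‖ ^ 2 = ‖t‖ ^ 2 - ⟪u, t⟫ ^ 2 := by
  rw [norm_sub_sq_real, norm_smul, hu, real_inner_smul_right, real_inner_comm u t,
    Real.norm_eq_abs, mul_one, sq_abs]
  ring

/-- The density of the standard Gaussian measure with respect to Lebesgue measure. -/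
noncomputable def stdGaussianPDFReal (x : E) : ℝ :=
  (2 * Real.pi) ^ (-(Module.finrank ℝ E : ℝ) / 2) * Real.exp (-‖x‖ ^ 2 / 2)

lemma stdGaussianPDFReal_nonneg (x : E) : 0 ≤ stdGaussianPDFReal x := by
  unfold stdGaussianPDFReal
  positivity

/-- Completing the square, with the coefficient of `‖·‖ ^ 2` parametrized by the scale `κ` of the
resulting Gaussian. -/
lemma exp_mul_stdGaussianPDFReal_smul_add {κ : ℝ} (hκ : κ ≠ 0) (v x : E) :
    Real.exp (⟪v, κ • x + κ ^ 2 • v⟫ + (1 - (κ ^ 2)⁻¹) / 2 * ‖κ • x + κ ^ 2 • v‖ ^ 2) *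
        stdGaussianPDFReal (κ • x + κ ^ 2 • v) =
      Real.exp (κ ^ 2 * ‖v‖ ^ 2 / 2) * stdGaussianPDFReal x := by
  rw [stdGaussianPDFReal, stdGaussianPDFReal, mul_left_comm, mul_left_comm (Real.exp _),
    ← Real.exp_add, ← Real.exp_add, norm_add_sq_real, norm_smul, norm_smul, inner_add_right,
    real_inner_smul_right, real_inner_smul_right, real_inner_smul_left, real_inner_smul_right,
    real_inner_self_eq_norm_sq, real_inner_comm x v, mul_pow, mul_pow, Real.norm_eq_abs,
    Real.norm_eq_abs, sq_abs, sq_abs]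
  congr 2
  field_simp
  ring

variable [MeasurableSpace E] [BorelSpace E]

@[fun_prop]
lemma measurable_stdGaussianPDFReal : Measurable (stdGaussianPDFReal : E → ℝ) := by
  unfold stdGaussianPDFReal
  fun_prop

variable [FiniteDimensional ℝ E]

lemma stdGaussian_map_resample {u : E} (hu : ‖u‖ = 1) :
    ((stdGaussian E).prod (gaussianReal 0 1)).map (fun z : E × ℝ => z.1 - ⟪u, z.1⟫ • u + z.2 • u) =
      stdGaussian E := by
  have hmeas : Measurable (fun z : E × ℝ => z.1 - ⟪u, z.1⟫ • u + z.2 • u) :=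
    Continuous.measurable (by fun_prop)
  have := Measure.isProbabilityMeasure_map (μ := (stdGaussian E).prod (gaussianReal 0 1))
    hmeas.aemeasurable
  refine Measure.ext_of_charFun (funext fun t => ?_)
  have hsplit : ∀ z : E × ℝ, Complex.exp (⟪z.1 - ⟪u, z.1⟫ • u + z.2 • u, t⟫ * Complex.I) =
      Complex.exp (⟪z.1, t - ⟪u, t⟫ • u⟫ * Complex.I) *
        Complex.exp (⟪u, t⟫ * z.2 * Complex.I) := by
    intro z
    rw [← Complex.exp_add, ← add_mul]
    congr 2
    simp only [inner_add_left, inner_sub_left, inner_sub_right, real_inner_smul_left,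
      real_inner_smul_right, real_inner_comm u z.1]
    push_cast
    ring
  rw [charFun_apply, integral_map hmeas.aemeasurable
    (Continuous.aestronglyMeasurable (by fun_prop))]
  simp_rw [hsplit]
  rw [integral_prod_mul (μ := stdGaussian E) (ν := gaussianReal 0 1)
    (fun x => Complex.exp (⟪x, t - ⟪u, t⟫ • u⟫ * Complex.I))
    (fun ξ => Complex.exp (⟪u, t⟫ * ξ * Complex.I)), ← charFun_apply, ← charFun_apply_real,
    charFun_stdGaussian, charFun_gaussianReal, charFun_stdGaussian, ← Complex.exp_add,
    ← Complex.ofReal_pow, norm_sq_sub_inner_smul hu]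
  congr 1
  push_cast
  ring

lemma lintegral_stdGaussian_resample {u : E} (hu : ‖u‖ = 1) {F : E → ENNReal}
    (hF : Measurable F) :
    ∫⁻ g, F g ∂(stdGaussian E) =
      ∫⁻ g, ∫⁻ ξ, F (g - ⟪u, g⟫ • u + ξ • u) ∂(gaussianReal 0 1) ∂(stdGaussian E) := by
  have hmeas : Measurable (fun z : E × ℝ => z.1 - ⟪u, z.1⟫ • u + z.2 • u) :=
    Continuous.measurable (by fun_prop)
  conv_lhs => rw [← stdGaussian_map_resample hu]
  rw [lintegral_map hF hmeas]
  exact lintegral_prod _ (hF.comp hmeas).aemeasurable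

lemma charFun_withDensity_stdGaussianPDFReal (t : E) :
    charFun ((volume : Measure E).withDensity fun x => ENNReal.ofReal (stdGaussianPDFReal x)) t =
      Complex.exp (-‖t‖ ^ 2 / 2) := by
  set n := Module.finrank ℝ E with hn
  have hintegrand : ∀ x : E, (ENNReal.ofReal (stdGaussianPDFReal x)).toReal •
      Complex.exp (⟪x, t⟫ * Complex.I) = ((2 * Real.pi) ^ (-(n : ℝ) / 2) : ℝ) *
        Complex.exp (-(1 / 2 : ℂ) * (‖x‖ : ℂ) ^ 2 + Complex.I * (⟪t, x⟫ : ℂ)) := by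
    intro x
    rw [ENNReal.toReal_ofReal (stdGaussianPDFReal_nonneg x), stdGaussianPDFReal, Complex.real_smul,
      Complex.exp_add, real_inner_comm, mul_comm Complex.I, ← hn]
    push_cast
    ring_nf
  have hconst : (((2 * Real.pi) ^ (-(n : ℝ) / 2) : ℝ) : ℂ) *
      (Real.pi / (1 / 2 : ℂ)) ^ ((n : ℂ) / 2) = 1 := by
    rw [show (Real.pi / (1 / 2 : ℂ)) = ((2 * Real.pi : ℝ) : ℂ) by push_cast; ring,
      show (n : ℂ) / 2 = ((n / 2 : ℝ) : ℂ) by push_cast; rfl,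
      ← Complex.ofReal_cpow (by positivity), ← Complex.ofReal_mul,
      ← Real.rpow_add (by positivity), neg_div, neg_add_cancel, Real.rpow_zero, Complex.ofReal_one]
  rw [charFun_apply, integral_withDensity_eq_integral_toReal_smul (by fun_prop) (by simp)]
  simp_rw [hintegrand]
  rw [integral_const_mul, GaussianFourier.integral_cexp_neg_mul_sq_norm_add (by norm_num),
    ← mul_assoc, hconst, one_mul, Complex.I_sq]
  ring_nf

lemma integrable_stdGaussianPDFReal : Integrable (stdGaussianPDFReal : E → ℝ) := by
  have hgauss := GaussianFourier.integrable_cexp_neg_mul_sq_norm_add (V := E) (b := 1 / 2)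
    (by norm_num) 0 0
  refine (hgauss.re.const_mul ((2 * Real.pi) ^ (-(Module.finrank ℝ E : ℝ) / 2))).congr
    (ae_of_all _ fun x => ?_)
  simp only [stdGaussianPDFReal, zero_mul, add_zero]
  rw [show (-(1 / 2 : ℂ) * (‖x‖ : ℂ) ^ 2) =
    ((-‖x‖ ^ 2 / 2 : ℝ) : ℂ) by push_cast; ring, ← Complex.ofReal_exp]
  rfl

lemma stdGaussian_eq_withDensity : stdGaussian E =
    (volume : Measure E).withDensity fun x => ENNReal.ofReal (stdGaussianPDFReal x) := by
  have := isFiniteMeasure_withDensity_ofReal (μ := (volume : Measure E))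
    integrable_stdGaussianPDFReal.2
  refine Measure.ext_of_charFun (funext fun t => ?_)
  rw [charFun_stdGaussian, charFun_withDensity_stdGaussianPDFReal]

lemma lintegral_stdGaussian {F : E → ENNReal} (hF : Measurable F) :
    ∫⁻ g, F g ∂(stdGaussian E) = ∫⁻ x, ENNReal.ofReal (stdGaussianPDFReal x) * F x := by
  rw [stdGaussian_eq_withDensity, lintegral_withDensity_eq_lintegral_mul _ (by fun_prop) hF]
  rfl

lemma lintegral_exp_quadratic_mul_stdGaussian {κ : ℝ} (hκ : 0 < κ) (v : E) {F : E → ENNReal}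
    (hF : Measurable F) :
    ∫⁻ g, ENNReal.ofReal (Real.exp (⟪v, g⟫ + (1 - (κ ^ 2)⁻¹) / 2 * ‖g‖ ^ 2)) * F g
        ∂(stdGaussian E) =
      ENNReal.ofReal (κ ^ Module.finrank ℝ E * Real.exp (κ ^ 2 * ‖v‖ ^ 2 / 2)) *
        ∫⁻ g, F (κ • g + κ ^ 2 • v) ∂(stdGaussian E) := by
  rw [lintegral_stdGaussian (by fun_prop), lintegral_stdGaussian (by fun_prop),
    lintegral_eq_ofReal_pow_mul_lintegral_comp_smul_add volume hκ (κ ^ 2 • v) (by fun_prop),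
    ENNReal.ofReal_mul (by positivity), mul_assoc]
  congr 1
  rw [← lintegral_const_mul _ (by fun_prop)]
  refine lintegral_congr fun x => ?_
  rw [← mul_assoc, ← mul_assoc, ← ENNReal.ofReal_mul (stdGaussianPDFReal_nonneg _),
    ← ENNReal.ofReal_mul (by positivity), mul_comm (stdGaussianPDFReal _),
    exp_mul_stdGaussianPDFReal_smul_add hκ.ne']

lemma setLIntegral_exp_quadratic_stdGaussian {κ : ℝ} (hκ : 0 < κ) (v : E) {B : Set E}
    (hB : MeasurableSet B) :
    ∫⁻ g in B, ENNReal.ofReal (Real.exp (⟪v, g⟫ + (1 - (κ ^ 2)⁻¹) / 2 * ‖g‖ ^ 2))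
        ∂(stdGaussian E) =
      ENNReal.ofReal (κ ^ Module.finrank ℝ E * Real.exp (κ ^ 2 * ‖v‖ ^ 2 / 2)) *
        stdGaussian E {g | κ • g + κ ^ 2 • v ∈ B} := by
  have hpreimage : ∫⁻ g, B.indicator 1 (κ • g + κ ^ 2 • v) ∂(stdGaussian E) =
      stdGaussian E {g | κ • g + κ ^ 2 • v ∈ B} :=
    lintegral_indicator_one (measurableSet_preimage (by fun_prop) hB)
  rw [← hpreimage, ← lintegral_exp_quadratic_mul_stdGaussian hκ v (measurable_one.indicator hB),
    ← lintegral_indicator hB]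
  refine lintegral_congr fun g => ?_
  by_cases hg : g ∈ B <;> simp [hg]

lemma setLIntegral_exp_inner_stdGaussian (v : E) {B : Set E} (hB : MeasurableSet B) :
    ∫⁻ g in B, ENNReal.ofReal (Real.exp ⟪v, g⟫) ∂(stdGaussian E) =
      ENNReal.ofReal (Real.exp (‖v‖ ^ 2 / 2)) * stdGaussian E {g | g + v ∈ B} := by
  simpa using setLIntegral_exp_quadratic_stdGaussian one_pos v hB

end StdGaussian

/-! ### Gram–Schmidt residuals and Gaussian orthant probabilities -/

section Prefix

variable {E : Type*} [NormedAddCommGroup E] [InnerProductSpace ℝ E] [FiniteDimensional ℝ E]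
  {ι : Type*} [Preorder ι]

/-- The orthogonal projection of `x i` to the span of the earlier vectors `x j`, `j < i`. -/
noncomputable def prefixProj (x : ι → E) (i : ι) : E :=
  (Submodule.span ℝ (x '' {j | j < i})).starProjection (x i)

/-- The Gram–Schmidt residual of `x i`: its component orthogonal to the earlier vectors. -/
noncomputable def prefixResidual (x : ι → E) (i : ι) : E := x i - prefixProj x i

lemma prefixProj_add_prefixResidual (x : ι → E) (i : ι) :
    prefixProj x i + prefixResidual x i = x i :=
  add_sub_cancel _ _

lemma inner_prefixResidual_of_mem_span {x : ι → E} {i : ι} {v : E}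
    (hv : v ∈ Submodule.span ℝ (x '' {j | j < i})) : ⟪prefixResidual x i, v⟫ = 0 :=
  Submodule.inner_left_of_mem_orthogonal hv (Submodule.sub_starProjection_mem_orthogonal (x i))

lemma inner_prefixResidual_of_lt (x : ι → E) {i j : ι} (hji : j < i) :
    ⟪prefixResidual x i, x j⟫ = 0 :=
  inner_prefixResidual_of_mem_span (Submodule.subset_span ⟨j, hji, rfl⟩)

lemma inner_prefixResidual_prefixProj (x : ι → E) (i : ι) :
    ⟪prefixResidual x i, prefixProj x i⟫ = 0 :=
  inner_prefixResidual_of_mem_span (Submodule.starProjection_apply_mem _ _)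

lemma exists_unit_eq_prefixProj_add_smul {x : ι → E} {i : ι} (hx : 0 < ‖prefixResidual x i‖) :
    ∃ u : E, ‖u‖ = 1 ∧ x i = prefixProj x i + ‖prefixResidual x i‖ • u ∧
      ⟪prefixProj x i, u⟫ = 0 ∧ ∀ j < i, ⟪x j, u⟫ = 0 := by
  refine ⟨‖prefixResidual x i‖⁻¹ • prefixResidual x i, norm_smul_inv_norm (norm_pos_iff.1 hx),
    ?_, ?_, fun j hji => ?_⟩
  · rw [smul_inv_smul₀ hx.ne', prefixProj_add_prefixResidual]
  · rw [real_inner_smul_right, real_inner_comm, inner_prefixResidual_prefixProj, mul_zero]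
  · rw [real_inner_smul_right, real_inner_comm, inner_prefixResidual_of_lt x hji, mul_zero]

lemma prefixProj_comp_castSucc {m : ℕ} (x : Fin (m + 1) → E) (i : Fin m) :
    prefixProj (x ∘ Fin.castSucc) i = prefixProj x i.castSucc := by
  have himage : x ∘ Fin.castSucc '' {j | j < i} = x '' {j | j < i.castSucc} := by
    rw [Set.image_comp]
    congr 1
    ext j
    constructor
    · rintro ⟨k, hk, rfl⟩
      exact Fin.castSucc_lt_castSucc_iff.2 hk
    · intro hj
      obtain ⟨k, rfl⟩ := Fin.exists_castSucc_eq.2 (hj.trans (Fin.castSucc_lt_last i)).ne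
      exact ⟨k, Fin.castSucc_lt_castSucc_iff.1 hj, rfl⟩
  simp_rw [prefixProj, himage]
  rfl

lemma prefixResidual_comp_castSucc {m : ℕ} (x : Fin (m + 1) → E) (i : Fin m) :
    prefixResidual (x ∘ Fin.castSucc) i = prefixResidual x i.castSucc := by
  rw [prefixResidual, prefixResidual, prefixProj_comp_castSucc, Function.comp_apply]

end Prefix

section Orthant

variable {E : Type*} [NormedAddCommGroup E] [InnerProductSpace ℝ E]

/-- The intersection of the halfspaces `⟪x i, g⟫ ≤ τ i`. -/
def orthant {ι : Type*} (x : ι → E) (τ : ι → ℝ) : Set E := {g | ∀ i, ⟪x i, g⟫ ≤ τ i}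

lemma measurableSet_orthant {ι : Type*} [Countable ι] [MeasurableSpace E] [BorelSpace E]
    (x : ι → E) (τ : ι → ℝ) : MeasurableSet (orthant x τ) := by
  rw [orthant, Set.ofPred_forall]
  exact MeasurableSet.iInter fun i =>
    (isClosed_le (by fun_prop) continuous_const).measurableSet

lemma smul_add_mem_orthant_iff {ι : Type*} {x : ι → E} {τ : ι → ℝ} {κ : ℝ} (hκ : 0 < κ)
    (g v : E) : κ • g + v ∈ orthant x τ ↔ g ∈ orthant x fun i => (τ i - ⟪x i, v⟫) / κ := by
  refine forall_congr' fun i => ?_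
  rw [inner_add_right, real_inner_smul_right, le_div_iff₀ hκ, le_sub_iff_add_le, mul_comm κ]

lemma add_mem_orthant_iff {ι : Type*} {x : ι → E} {τ : ι → ℝ} (g v : E) :
    g + v ∈ orthant x τ ↔ g ∈ orthant x fun i => τ i - ⟪x i, v⟫ := by
  simpa using smul_add_mem_orthant_iff (x := x) (τ := τ) one_pos g v

lemma orthant_eq_inter {m : ℕ} (x : Fin (m + 1) → E) (τ : Fin (m + 1) → ℝ) :
    orthant x τ = orthant (x ∘ Fin.castSucc) (τ ∘ Fin.castSucc) ∩
      {g | ⟪x (Fin.last m), g⟫ ≤ τ (Fin.last m)} :=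
  Set.ext fun _ => Fin.forall_fin_succ'

lemma norm_sq_sum_inv_smul_castSucc [FiniteDimensional ℝ E] {m : ℕ} (x : Fin (m + 1) → E)
    (hx : 0 < ‖prefixResidual x (Fin.last m)‖) :
    ‖∑ i, ‖prefixResidual x i‖⁻¹ • x i‖ ^ 2 =
      ‖∑ i : Fin m, ‖prefixResidual x i.castSucc‖⁻¹ • x i.castSucc‖ ^ 2 +
        2 / ‖prefixResidual x (Fin.last m)‖ *
          ⟪∑ i : Fin m, ‖prefixResidual x i.castSucc‖⁻¹ • x i.castSucc,
            prefixProj x (Fin.last m)⟫ +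
        (‖prefixResidual x (Fin.last m)‖⁻¹ ^ 2 * ‖prefixProj x (Fin.last m)‖ ^ 2 + 1) := by
  obtain ⟨u, hu, hlast, hyu, hxu⟩ := exists_unit_eq_prefixProj_add_smul hx
  rw [Fin.sum_univ_castSucc]
  set Y := ∑ i : Fin m, ‖prefixResidual x i.castSucc‖⁻¹ • x i.castSucc with hY
  set L := ‖prefixResidual x (Fin.last m)‖
  set y := prefixProj x (Fin.last m)
  have hYu : ⟪Y, u⟫ = 0 := by
    rw [hY, sum_inner]
    exact Finset.sum_eq_zero fun i _ => by
      rw [real_inner_smul_left, hxu _ (Fin.castSucc_lt_last i), mul_zero]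
  rw [hlast, smul_add, smul_smul, inv_mul_cancel₀ hx.ne', one_smul, ← add_assoc,
    norm_add_sq_real (Y + L⁻¹ • y) u, inner_add_left, hYu, real_inner_smul_left, hyu, hu,
    norm_add_sq_real, norm_smul, real_inner_smul_right, norm_inv, Real.norm_of_nonneg hx.le]
  ring

variable [FiniteDimensional ℝ E] [MeasurableSpace E] [BorelSpace E]

lemma stdGaussian_inter_halfspace {u y : E} {L : ℝ} (hL : 0 < L) (hu : ‖u‖ = 1)
    (hyu : ⟪y, u⟫ = 0) {B : Set E} (hB : MeasurableSet B)
    (hBu : ∀ (g : E) (s : ℝ), g + s • u ∈ B ↔ g ∈ B) (τ : ℝ) :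
    stdGaussian E (B ∩ {g | ⟪y + L • u, g⟫ ≤ τ}) =
      ∫⁻ g in B, ENNReal.ofReal (gaussCDF ((τ - ⟪y, g⟫) / L)) ∂(stdGaussian E) := by
  classical
  have hA : MeasurableSet (B ∩ {g | ⟪y + L • u, g⟫ ≤ τ}) :=
    hB.inter (isClosed_le (by fun_prop) continuous_const).measurableSet
  rw [← lintegral_indicator_one hA,
    lintegral_stdGaussian_resample hu (measurable_one.indicator hA), ← lintegral_indicator hB]
  refine lintegral_congr fun g => ?_
  have hmemB : ∀ ξ : ℝ, g - ⟪u, g⟫ • u + ξ • u ∈ B ↔ g ∈ B := fun ξ => by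
    rw [sub_add_eq_add_sub, add_sub_assoc, ← sub_smul, hBu]
  have hmemA : ∀ ξ : ℝ, g - ⟪u, g⟫ • u + ξ • u ∈ B ∩ {g | ⟪y + L • u, g⟫ ≤ τ} ↔
      g ∈ B ∧ ξ ∈ Set.Iic ((τ - ⟪y, g⟫) / L) := by
    refine fun ξ => and_congr (hmemB ξ) ?_
    rw [Set.mem_ofPred_eq, Set.mem_Iic, le_div_iff₀ hL]
    simp only [inner_add_left, inner_add_right, inner_sub_right, real_inner_smul_left,
      real_inner_smul_right, hyu, real_inner_self_eq_norm_sq, hu]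
    constructor <;> intro h <;> linarith
  by_cases hg : g ∈ B
  · have hindicator : ∀ ξ : ℝ, ((B ∩ {g | ⟪y + L • u, g⟫ ≤ τ}).indicator 1
        (g - ⟪u, g⟫ • u + ξ • u) : ENNReal) = (Set.Iic ((τ - ⟪y, g⟫) / L)).indicator 1 ξ :=
      fun ξ => by simp only [Set.indicator_apply, hmemA, hg, true_and, Pi.one_apply]
    simp_rw [hindicator]
    rw [lintegral_indicator_one measurableSet_Iic, Set.indicator_of_mem hg, gaussCDF,
      ofReal_measureReal]
  · simp [hmemA, hg]

/-- Log-concavity of `Φ` bounds the conditional probability of the halfspace by an exponential of a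
linear functional, which acts as a Cameron–Martin shift on the remaining event `B`. -/
lemma stdGaussian_inter_halfspace_le {u y : E} {L : ℝ} (hL : 0 < L) (hu : ‖u‖ = 1)
    (hyu : ⟪y, u⟫ = 0) {B : Set E} (hB : MeasurableSet B)
    (hBu : ∀ (g : E) (s : ℝ), g + s • u ∈ B ↔ g ∈ B) (τ t : ℝ) :
    stdGaussian E (B ∩ {g | ⟪y + L • u, g⟫ ≤ τ}) ≤
      ENNReal.ofReal (gaussCDF t * Real.exp (gaussHazard t * (τ / L - t) +
          gaussHazard t ^ 2 / 2 * (L⁻¹ ^ 2 * ‖y‖ ^ 2))) *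
        stdGaussian E {g | g + (-(gaussHazard t / L)) • y ∈ B} := by
  have hq := (gaussCDF_pos t).le
  have htangent : ∀ g, ENNReal.ofReal (gaussCDF ((τ - ⟪y, g⟫) / L)) ≤
      ENNReal.ofReal (gaussCDF t * Real.exp (gaussHazard t * (τ / L - t))) *
        ENNReal.ofReal (Real.exp ⟪(-(gaussHazard t / L)) • y, g⟫) := fun g => by
    rw [← ENNReal.ofReal_mul (by positivity), mul_assoc, ← Real.exp_add, real_inner_smul_left]
    refine ENNReal.ofReal_le_ofReal ((gaussCDF_le_tangent t _).trans_eq ?_)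
    ring_nf
  calc stdGaussian E (B ∩ {g | ⟪y + L • u, g⟫ ≤ τ})
      ≤ ∫⁻ g in B, ENNReal.ofReal (gaussCDF t * Real.exp (gaussHazard t * (τ / L - t))) *
          ENNReal.ofReal (Real.exp ⟪(-(gaussHazard t / L)) • y, g⟫) ∂(stdGaussian E) := by
        rw [stdGaussian_inter_halfspace hL hu hyu hB hBu]
        exact lintegral_mono htangent
    _ = _ := by
        rw [lintegral_const_mul _ (by fun_prop), setLIntegral_exp_inner_stdGaussian _ hB,
          ← mul_assoc, ← ENNReal.ofReal_mul (by positivity), mul_assoc, ← Real.exp_add, norm_smul,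
          mul_pow, Real.norm_eq_abs, sq_abs]
        ring_nf

lemma stdGaussian_orthant_succ_le (t : ℝ) {m : ℕ} (x : Fin (m + 1) → E) (τ : Fin (m + 1) → ℝ)
    (hx : 0 < ‖prefixResidual x (Fin.last m)‖) :
    stdGaussian E (orthant x τ) ≤
      ENNReal.ofReal (gaussCDF t * Real.exp
          (gaussHazard t * (τ (Fin.last m) / ‖prefixResidual x (Fin.last m)‖ - t) +
            gaussHazard t ^ 2 / 2 *
              (‖prefixResidual x (Fin.last m)‖⁻¹ ^ 2 * ‖prefixProj x (Fin.last m)‖ ^ 2))) *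
        stdGaussian E (orthant (x ∘ Fin.castSucc) fun i => τ i.castSucc +
          gaussHazard t / ‖prefixResidual x (Fin.last m)‖ *
            ⟪x i.castSucc, prefixProj x (Fin.last m)⟫) := by
  obtain ⟨u, hu, hlast, hyu, hxu⟩ := exists_unit_eq_prefixProj_add_smul hx
  have hinvariant : ∀ (g : E) (s : ℝ), g + s • u ∈ orthant (x ∘ Fin.castSucc) (τ ∘ Fin.castSucc) ↔
      g ∈ orthant (x ∘ Fin.castSucc) (τ ∘ Fin.castSucc) := fun g s => by
    simp [add_mem_orthant_iff, real_inner_smul_right, hxu _ (Fin.castSucc_lt_last _),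
      Function.comp_def]
  have hstep := stdGaussian_inter_halfspace_le hx hu hyu (measurableSet_orthant _ _) hinvariant
    (τ (Fin.last m)) t
  rw [← hlast, ← orthant_eq_inter] at hstep
  simpa only [add_mem_orthant_iff, Set.ofPred_mem_eq, Function.comp_apply, real_inner_smul_right,
    neg_mul, sub_neg_eq_add] using hstep

lemma stdGaussian_orthant_le (t : ℝ) {m : ℕ} (x : Fin m → E) (τ : Fin m → ℝ)
    (hx : ∀ i, 0 < ‖prefixResidual x i‖) :
    stdGaussian E (orthant x τ) ≤ ENNReal.ofReal (gaussCDF t ^ m *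
      Real.exp (gaussHazard t * ∑ i, (τ i / ‖prefixResidual x i‖ - t) +
        gaussHazard t ^ 2 / 2 * (‖∑ i, ‖prefixResidual x i‖⁻¹ • x i‖ ^ 2 - m))) := by
  induction m with
  | zero => simpa using prob_le_one
  | succ m ih =>
    have hq := (gaussCDF_pos t).le
    have hresidual : ∀ i : Fin m,
        prefixResidual (x ∘ Fin.castSucc) i = prefixResidual x i.castSucc :=
      prefixResidual_comp_castSucc x
    have hthreshold : ∑ i : Fin m, ((τ i.castSucc +
          gaussHazard t / ‖prefixResidual x (Fin.last m)‖ *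
            ⟪x i.castSucc, prefixProj x (Fin.last m)⟫) / ‖prefixResidual x i.castSucc‖ - t) =
        ∑ i : Fin m, (τ i.castSucc / ‖prefixResidual x i.castSucc‖ - t) +
          gaussHazard t / ‖prefixResidual x (Fin.last m)‖ *
            ⟪∑ i : Fin m, ‖prefixResidual x i.castSucc‖⁻¹ • x i.castSucc,
              prefixProj x (Fin.last m)⟫ := by
      rw [sum_inner, Finset.mul_sum, ← Finset.sum_add_distrib]
      refine Finset.sum_congr rfl fun i _ => ?_
      rw [real_inner_smul_left]
      ring
    refine (stdGaussian_orthant_succ_le t x τ (hx _)).trans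
      ((mul_le_mul_right (ih (x ∘ Fin.castSucc) _ fun i => ?_) _).trans_eq ?_)
    · rw [hresidual]
      exact hx _
    simp only [hresidual, Function.comp_apply]
    rw [← ENNReal.ofReal_mul (by positivity), hthreshold, mul_mul_mul_comm, ← pow_succ',
      ← Real.exp_add, norm_sq_sum_inv_smul_castSucc x (hx _), Fin.sum_univ_castSucc]
    push_cast
    ring_nf

/-- Completing the square turns the quadratic tilt into a rescaling by `κ` and a shift of the
thresholds. -/
lemma setLIntegral_orthant_exp_quadratic_le {κ : ℝ} (hκ : 0 < κ) (t : ℝ) {m : ℕ} (x : Fin m → E)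
    (τ : Fin m → ℝ) (v : E) (hx : ∀ i, 0 < ‖prefixResidual x i‖) :
    ∫⁻ g in orthant x τ, ENNReal.ofReal (Real.exp (⟪v, g⟫ + (1 - (κ ^ 2)⁻¹) / 2 * ‖g‖ ^ 2))
        ∂(stdGaussian E) ≤
      ENNReal.ofReal (κ ^ Module.finrank ℝ E * gaussCDF t ^ m *
        Real.exp (κ ^ 2 * ‖v‖ ^ 2 / 2 +
          gaussHazard t * ∑ i, ((τ i / κ - κ * ⟪x i, v⟫) / ‖prefixResidual x i‖ - t) +
          gaussHazard t ^ 2 / 2 * (‖∑ i, ‖prefixResidual x i‖⁻¹ • x i‖ ^ 2 - m))) := by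
  have := (gaussCDF_pos t).le
  have hthreshold : ∀ i, (τ i - κ ^ 2 * ⟪x i, v⟫) / κ = τ i / κ - κ * ⟪x i, v⟫ := fun i => by
    field_simp
  rw [setLIntegral_exp_quadratic_stdGaussian hκ v (measurableSet_orthant _ _)]
  simp only [smul_add_mem_orthant_iff hκ, Set.ofPred_mem_eq, real_inner_smul_right, hthreshold]
  refine (mul_le_mul_right (stdGaussian_orthant_le t x _ hx) _).trans_eq ?_
  rw [← ENNReal.ofReal_mul (by positivity), mul_mul_mul_comm, ← Real.exp_add, ← add_assoc]

end Orthant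

/-! ### Norm fluctuations -/

section Scalar

lemma abs_one_sub_inv_sub_le {L : ℝ} (hL : 1 / 2 ≤ L) :
    |1 - L⁻¹ - (L ^ 2 - 1) / 2| ≤ 2 * (L ^ 2 - 1) ^ 2 := by
  have hpos : 0 < L := by linarith
  have hremainder : 1 - L⁻¹ - (L ^ 2 - 1) / 2 = -((L - 1) ^ 2 * ((L + 2) / (2 * L))) := by
    field_simp
    ring
  have hcoeff : (L + 2) / (2 * L) ≤ 2 * (L + 1) ^ 2 := by
    rw [div_le_iff₀ (by positivity)]
    nlinarith [mul_pos hpos hpos, mul_pos (mul_pos hpos hpos) hpos]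
  rw [hremainder, abs_neg, abs_of_nonneg (by positivity)]
  calc (L - 1) ^ 2 * ((L + 2) / (2 * L)) ≤ (L - 1) ^ 2 * (2 * (L + 1) ^ 2) := by gcongr
    _ = 2 * (L ^ 2 - 1) ^ 2 := by ring

/-- A quadratic majorant of `b * (1 - 1 / ‖x‖)` for `|b| ≤ B`, as a function of `s = ‖x‖ ^ 2 - 1`.
It records the price of the deviation of `‖x‖` from `1`. -/
noncomputable def normPotential (B b s : ℝ) : ℝ := b / 2 * s + 4 * B * s ^ 2

lemma mul_one_sub_inv_le_normPotential {B b L s e : ℝ} (hb : |b| ≤ B) (hL : 1 / 2 ≤ L)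
    (hLs : L ^ 2 = 1 + s - e) (he0 : 0 ≤ e) (he1 : e ≤ 1) :
    b * (1 - L⁻¹) ≤ normPotential B b s + 5 * B * e := by
  have hB : 0 ≤ B := (abs_nonneg b).trans hb
  have hremainder : b * (1 - L⁻¹ - (L ^ 2 - 1) / 2) ≤ B * (2 * (L ^ 2 - 1) ^ 2) := by
    refine (le_abs_self _).trans ?_
    rw [abs_mul]
    exact mul_le_mul hb (abs_one_sub_inv_sub_le hL) (abs_nonneg _) hB
  have hsq : (L ^ 2 - 1) ^ 2 ≤ 2 * s ^ 2 + 2 * e := by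
    rw [hLs]
    nlinarith [sq_nonneg (s + e), mul_le_of_le_one_right he0 he1]
  have hlinear : -(b / 2 * e) ≤ B / 2 * e := by nlinarith [(abs_le.1 hb).1]
  have hBe := mul_nonneg hB he0
  calc b * (1 - L⁻¹) = b / 2 * s - b / 2 * e + b * (1 - L⁻¹ - (L ^ 2 - 1) / 2) := by
        rw [hLs]
        ring
    _ ≤ b / 2 * s + B / 2 * e + B * (2 * (2 * s ^ 2 + 2 * e)) := by
        linarith [mul_le_mul_of_nonneg_left hsq hB]
    _ ≤ normPotential B b s + 5 * B * e := by
        rw [normPotential]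
        linarith

lemma sq_le_two_mul_exp_add_exp_neg (y : ℝ) : y ^ 2 ≤ 2 * (Real.exp y + Real.exp (-y)) := by
  have hquadratic := Real.quadratic_le_exp_of_nonneg (abs_nonneg y)
  rw [sq_abs] at hquadratic
  have habs := Real.exp_abs_le y
  linarith [abs_nonneg y]

/-- The quadratic part of the potential is traded for two further linear tilts, at the natural
scale `w` of the fluctuations of `‖x‖ ^ 2`. -/
lemma exp_normPotential_le {B b w n s : ℝ} (hB : 0 ≤ B) (hw : 0 < w) (hn : 0 ≤ n)
    (hs : n * (4 * B * s ^ 2) ≤ 1) :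
    Real.exp (n * normPotential B b s) ≤ Real.exp (n * (b / 2) * s) +
      16 * B * n * w ^ 2 * Real.exp ((n * (b / 2) + w⁻¹) * s) +
      16 * B * n * w ^ 2 * Real.exp ((n * (b / 2) - w⁻¹) * s) := by
  have hlinear : Real.exp (n * (4 * B * s ^ 2)) ≤ 1 + 2 * (n * (4 * B * s ^ 2)) := by
    have hnonneg : 0 ≤ n * (4 * B * s ^ 2) := by positivity
    have hexp := Real.abs_exp_sub_one_le (abs_le.2 ⟨by linarith, hs⟩)
    rw [abs_of_nonneg hnonneg] at hexp
    linarith [le_abs_self (Real.exp (n * (4 * B * s ^ 2)) - 1)]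
  have hsq : s ^ 2 ≤ w ^ 2 * (2 * (Real.exp (w⁻¹ * s) + Real.exp (-(w⁻¹ * s)))) :=
    calc s ^ 2 = w ^ 2 * (w⁻¹ * s) ^ 2 := by field_simp
      _ ≤ _ := by gcongr; exact sq_le_two_mul_exp_add_exp_neg _
  have hpotential : n * normPotential B b s = n * (b / 2) * s + n * (4 * B * s ^ 2) := by
    rw [normPotential]
    ring
  rw [hpotential, add_mul, sub_mul, sub_eq_add_neg, Real.exp_add, Real.exp_add, Real.exp_add]
  calc Real.exp (n * (b / 2) * s) * Real.exp (n * (4 * B * s ^ 2))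
      ≤ Real.exp (n * (b / 2) * s) * (1 + 8 * B * n *
          (w ^ 2 * (2 * (Real.exp (w⁻¹ * s) + Real.exp (-(w⁻¹ * s)))))) := by
        gcongr
        refine hlinear.trans ?_
        linarith [mul_le_mul_of_nonneg_left hsq (by positivity : 0 ≤ 8 * B * n)]
    _ = _ := by ring

lemma inv_one_sub_le_exp {x : ℝ} (hx : |x| ≤ 1 / 2) : (1 - x)⁻¹ ≤ Real.exp (x + x ^ 2) := by
  have hx2 := (abs_le.1 hx).2
  rcases le_total x 0 with h | h
  · refine le_trans ?_ (Real.add_one_le_exp _)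
    rw [inv_le_iff_one_le_mul₀ (by linarith)]
    nlinarith [mul_nonneg (sq_nonneg x) (neg_nonneg.2 h)]
  · refine le_trans ?_ (Real.quadratic_le_exp_of_nonneg (by positivity))
    rw [inv_le_iff_one_le_mul₀ (by linarith)]
    nlinarith [mul_nonneg h h, mul_nonneg (mul_nonneg h h) h,
      mul_nonneg (mul_nonneg (mul_nonneg h h) h) (sub_nonneg.2 hx2),
      mul_nonneg (mul_nonneg h h) (sub_nonneg.2 hx2)]

lemma exp_neg_mul_pow_le {θ w κ : ℝ} {d : ℕ} (hd : (d : ℝ) * w ^ 2 = 1)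
    (hθ : 2 * θ * w ^ 2 = 1 - (κ ^ 2)⁻¹) (hsmall : |2 * θ * w ^ 2| ≤ 1 / 2) :
    Real.exp (-θ) * κ ^ d ≤ Real.exp (2 * θ ^ 2 * w ^ 2) := by
  set x := 2 * θ * w ^ 2
  have hκ : κ ^ 2 = (1 - x)⁻¹ := by rw [hθ, sub_sub_cancel, inv_inv]
  have hexponent : (d : ℝ) * (x + x ^ 2) = (2 : ℕ) * (θ + 2 * θ ^ 2 * w ^ 2) := by
    push_cast
    linear_combination (2 * θ + 4 * θ ^ 2 * w ^ 2) * hd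
  have hsq : (κ ^ d) ^ 2 ≤ (Real.exp (θ + 2 * θ ^ 2 * w ^ 2)) ^ 2 :=
    calc (κ ^ d) ^ 2 = ((1 - x)⁻¹) ^ d := by rw [← hκ, pow_right_comm]
      _ ≤ (Real.exp (x + x ^ 2)) ^ d :=
        pow_le_pow_left₀ (inv_nonneg.2 (by linarith [(abs_le.1 hsmall).2]))
          (inv_one_sub_le_exp hsmall) d
      _ = (Real.exp (θ + 2 * θ ^ 2 * w ^ 2)) ^ 2 := by
        rw [← Real.exp_nat_mul, ← Real.exp_nat_mul, hexponent]
  calc Real.exp (-θ) * κ ^ d ≤ Real.exp (-θ) * Real.exp (θ + 2 * θ ^ 2 * w ^ 2) := by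
        gcongr
        exact le_of_sq_le_sq hsq (Real.exp_pos _).le
    _ = Real.exp (2 * θ ^ 2 * w ^ 2) := by rw [← Real.exp_add, neg_add_cancel_left]

section RescalingFactor

variable {κ x : ℝ}

lemma exists_pos_eq_one_sub_inv_sq (hx : x < 1) : ∃ κ : ℝ, 0 < κ ∧ x = 1 - (κ ^ 2)⁻¹ := by
  refine ⟨(√(1 - x))⁻¹, inv_pos.2 (Real.sqrt_pos.2 (sub_pos.2 hx)), ?_⟩
  rw [inv_pow, inv_inv, Real.sq_sqrt (sub_pos.2 hx).le, sub_sub_cancel]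

lemma sq_le_two_of_eq_one_sub_inv_sq (hx : x = 1 - (κ ^ 2)⁻¹) (hsmall : |x| ≤ 1 / 2) :
    κ ^ 2 ≤ 2 := by
  have hκ : κ ^ 2 = (1 - x)⁻¹ := by rw [hx, sub_sub_cancel, inv_inv]
  rw [hκ, inv_le_comm₀ (by linarith [(abs_le.1 hsmall).2]) two_pos]
  linarith [(abs_le.1 hsmall).2]

lemma abs_one_sub_inv_le_of_eq_one_sub_inv_sq (hκ : 0 < κ) (hx : x = 1 - (κ ^ 2)⁻¹) :
    |1 - κ⁻¹| ≤ |x| := by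
  have hfactor : x = (1 - κ⁻¹) * (1 + κ⁻¹) := by rw [hx, ← inv_pow]; ring
  have hinv := inv_pos.2 hκ
  rw [hfactor, abs_mul, abs_of_pos (add_pos one_pos hinv)]
  exact le_mul_of_one_le_right (abs_nonneg _) (by linarith)

lemma abs_sub_one_le_of_eq_one_sub_inv_sq (hκ : 0 < κ) (hx : x = 1 - (κ ^ 2)⁻¹)
    (hsmall : |x| ≤ 1 / 2) : |κ - 1| ≤ |x| := by
  have hsq := sq_le_two_of_eq_one_sub_inv_sq hx hsmall
  have hfactor : x = (κ - 1) * ((κ + 1) / κ ^ 2) := by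
    rw [hx]
    field_simp
    ring
  rw [hfactor, abs_mul, abs_of_pos (a := (κ + 1) / κ ^ 2) (by positivity)]
  refine le_mul_of_one_le_right (abs_nonneg _) ((one_le_div (by positivity)).2 ?_)
  nlinarith

end RescalingFactor

lemma three_quarters_le_of_sq_eq {L s e η : ℝ} (hL0 : 0 ≤ L) (hLs : L ^ 2 = 1 + s - e)
    (hs : |s| ≤ η) (he : e ≤ η) (hη : η ≤ 1 / 8) : 3 / 4 ≤ L := by
  nlinarith [(abs_le.1 hs).1]

lemma abs_inv_sub_one_le {L s e η : ℝ} (hL0 : 0 ≤ L) (hLs : L ^ 2 = 1 + s - e) (hs : |s| ≤ η)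
    (he0 : 0 ≤ e) (he : e ≤ η) (hη : η ≤ 1 / 8) : |L⁻¹ - 1| ≤ 4 * η := by
  have hL := three_quarters_le_of_sq_eq hL0 hLs hs he hη
  obtain ⟨hs1, hs2⟩ := abs_le.1 hs
  have hfactor : L⁻¹ - 1 = (e - s) * (L * (1 + L))⁻¹ := by
    rw [show e - s = (1 - L) * (1 + L) by linarith]
    field_simp
  have hinv : (L * (1 + L))⁻¹ ≤ 2 := by
    rw [inv_le_comm₀ (by positivity) two_pos]
    nlinarith
  calc |L⁻¹ - 1| = |e - s| * (L * (1 + L))⁻¹ := by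
        rw [hfactor, abs_mul, abs_of_pos (a := (L * (1 + L))⁻¹) (by positivity)]
    _ ≤ 2 * η * 2 :=
        mul_le_mul (abs_le.2 ⟨by linarith, by linarith⟩) hinv (by positivity) (by linarith)
    _ = 4 * η := by ring

lemma abs_mul_sub_one_le {a b η : ℝ} (ha : |a - 1| ≤ 4 * η) (hb : |b - 1| ≤ 4 * η)
    (hη : η ≤ 1 / 16) : |a * b - 1| ≤ 10 * η := by
  have h0 : 0 ≤ η := by linarith [abs_nonneg (a - 1)]
  have hprod : |(a - 1) * (b - 1)| ≤ 4 * η * (4 * η) := by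
    rw [abs_mul]
    gcongr
  rw [show a * b - 1 = (a - 1) * (b - 1) + (a - 1) + (b - 1) by ring]
  refine (abs_add_three _ _ _).trans ?_
  nlinarith

end Scalar

section TiltedOrthant

variable {E : Type*} [NormedAddCommGroup E] [InnerProductSpace ℝ E] [FiniteDimensional ℝ E]
  [MeasurableSpace E] [BorelSpace E]

lemma setLIntegral_orthant_exp_tilt_le {w κ θ : ℝ} (hw : 0 < w) (hκ : 0 < κ)
    (hθ : 2 * θ * w ^ 2 = 1 - (κ ^ 2)⁻¹) (t : ℝ) {m : ℕ} (x : Fin m → E) (v : E)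
    (hx : ∀ i, 0 < ‖prefixResidual x i‖) :
    ∫⁻ g in orthant x fun _ => t * w, ENNReal.ofReal (Real.exp (⟪v, g⟫ + θ * (‖g‖ ^ 2 - 1)))
        ∂((stdGaussian E).map (w • ·)) ≤
      ENNReal.ofReal (Real.exp (-θ) * κ ^ Module.finrank ℝ E * gaussCDF t ^ m *
        Real.exp (κ ^ 2 * ‖w • v‖ ^ 2 / 2 +
          gaussHazard t * ∑ i, ((t / κ - κ * ⟪x i, w • v⟫) / ‖prefixResidual x i‖ - t) +
          gaussHazard t ^ 2 / 2 * (‖∑ i, ‖prefixResidual x i‖⁻¹ • x i‖ ^ 2 - m))) := by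
  have hpreimage : (w • · : E → E) ⁻¹' orthant x (fun _ => t * w) = orthant x fun _ => t := by
    ext g
    refine forall_congr' fun i => ?_
    rw [real_inner_smul_right, mul_comm t, mul_le_mul_iff_right₀ hw]
  have htilt : ∀ g : E, ENNReal.ofReal (Real.exp (⟪v, w • g⟫ + θ * (‖w • g‖ ^ 2 - 1))) =
      ENNReal.ofReal (Real.exp (-θ)) *
        ENNReal.ofReal (Real.exp (⟪w • v, g⟫ + (1 - (κ ^ 2)⁻¹) / 2 * ‖g‖ ^ 2)) := fun g => by
    rw [← ENNReal.ofReal_mul (Real.exp_pos _).le, ← Real.exp_add, ← hθ, norm_smul,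
      real_inner_smul_right, real_inner_smul_left, mul_pow, Real.norm_eq_abs, sq_abs]
    ring_nf
  rw [setLIntegral_map (measurableSet_orthant _ _) (by fun_prop) (by fun_prop), hpreimage]
  simp_rw [htilt]
  rw [lintegral_const_mul _ (by fun_prop)]
  refine (mul_le_mul_right (setLIntegral_orthant_exp_quadratic_le hκ t x _ _ hx) _).trans_eq ?_
  rw [← ENNReal.ofReal_mul (Real.exp_pos _).le]
  simp only [mul_assoc]

end TiltedOrthant

/-! ### Pair sums over cliques -/

section PairSum

variable {E : Type*} [NormedAddCommGroup E] {ι : Type*} [Fintype ι]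

/-- The sum of the inner products `⟪x i, x j⟫` over unordered pairs of distinct indices, expressed
through norms so that no order on the indices is needed. -/
noncomputable def pairSum (x : ι → E) : ℝ := (‖∑ i, x i‖ ^ 2 - ∑ i, ‖x i‖ ^ 2) / 2

lemma norm_sq_sum_eq (x : ι → E) : ‖∑ i, x i‖ ^ 2 = ∑ i, ‖x i‖ ^ 2 + 2 * pairSum x := by
  rw [pairSum]
  ring

lemma abs_sum_norm_sq_sub_card_le {x : ι → E} {δ : ℝ} (hx : ∀ i, |‖x i‖ ^ 2 - 1| ≤ δ) :
    |∑ i, ‖x i‖ ^ 2 - Fintype.card ι| ≤ Fintype.card ι * δ :=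
  calc |∑ i, ‖x i‖ ^ 2 - Fintype.card ι| = |∑ i, (‖x i‖ ^ 2 - 1)| := by simp
    _ ≤ ∑ i, |‖x i‖ ^ 2 - 1| := Finset.abs_sum_le_sum_abs _ _
    _ ≤ ∑ _i : ι, δ := Finset.sum_le_sum fun i _ => hx i
    _ = Fintype.card ι * δ := by simp

variable [InnerProductSpace ℝ E] [DecidableEq ι]

lemma norm_sq_sum_smul (x : ι → E) (a : ι → ℝ) :
    ‖∑ i, a i • x i‖ ^ 2 = ∑ i, a i ^ 2 * ‖x i‖ ^ 2 +
      ∑ i, ∑ j ∈ Finset.univ.erase i, a i * a j * ⟪x i, x j⟫ := by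
  rw [← real_inner_self_eq_norm_sq, sum_inner, ← Finset.sum_add_distrib]
  refine Finset.sum_congr rfl fun i _ => ?_
  rw [inner_sum, ← Finset.add_sum_erase _ _ (Finset.mem_univ i)]
  simp only [real_inner_smul_left, real_inner_smul_right]
  rw [real_inner_self_eq_norm_sq]
  exact congrArg₂ _ (by ring) (Finset.sum_congr rfl fun _ _ => by ring)

lemma two_mul_pairSum (x : ι → E) :
    2 * pairSum x = ∑ i, ∑ j ∈ Finset.univ.erase i, ⟪x i, x j⟫ := by
  have hexpand := norm_sq_sum_smul x fun _ => 1
  simp only [one_smul, one_pow, one_mul] at hexpand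
  rw [pairSum, hexpand]
  ring

lemma sum_sum_erase_le {f : ι → ι → ℝ} {b : ℝ} (hb : 0 ≤ b) (hf : ∀ i j, i ≠ j → f i j ≤ b) :
    ∑ i, ∑ j ∈ Finset.univ.erase i, f i j ≤ b * Fintype.card ι ^ 2 :=
  calc ∑ i, ∑ j ∈ Finset.univ.erase i, f i j ≤ ∑ i : ι, ∑ _j ∈ Finset.univ.erase i, b :=
        Finset.sum_le_sum fun i _ => Finset.sum_le_sum fun j hj =>
          hf i j (Finset.ne_of_mem_erase hj).symm
    _ ≤ ∑ _i : ι, ∑ _j : ι, b := Finset.sum_le_sum fun i _ =>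
        Finset.sum_le_sum_of_subset_of_nonneg (Finset.erase_subset _ _) fun _ _ _ => hb
    _ = b * Fintype.card ι ^ 2 := by
        simp only [Finset.sum_const, Finset.card_univ, nsmul_eq_mul]
        ring

/-- On a clique all the terms `σ * ⟪x i, x j⟫` are almost negative, so that their absolute values
add up to a linear function of the pair sum. -/
lemma sum_sum_abs_inner_le {x : ι → E} {σ t w M : ℝ} (hσ : |σ| = 1) (hw : 0 ≤ w) (ht : |t| ≤ M)
    (hx : ∀ i j, i ≠ j → σ * ⟪x i, x j⟫ ≤ t * w) :
    ∑ i, ∑ j ∈ Finset.univ.erase i, |⟪x i, x j⟫| ≤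
      -2 * σ * pairSum x + 2 * M * w * Fintype.card ι ^ 2 := by
  have hM : 0 ≤ M := (abs_nonneg t).trans ht
  have hpositivePart : ∀ i j, i ≠ j → |⟪x i, x j⟫| + σ * ⟪x i, x j⟫ ≤ 2 * M * w := by
    intro i j hij
    have habs : |⟪x i, x j⟫| = |σ * ⟪x i, x j⟫| := by rw [abs_mul, hσ, one_mul]
    have hMw : t * w ≤ M * w := mul_le_mul_of_nonneg_right ((le_abs_self t).trans ht) hw
    rw [habs]
    rcases abs_cases (σ * ⟪x i, x j⟫) with ⟨h, -⟩ | ⟨h, -⟩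
    · linarith [hx i j hij]
    · rw [h]
      linarith [mul_nonneg hM hw]
  have hsum := sum_sum_erase_le (by positivity) hpositivePart
  simp_rw [Finset.sum_add_distrib, ← Finset.mul_sum] at hsum
  rw [← two_mul_pairSum] at hsum
  linarith

lemma sum_abs_inner_sum_le (x : ι → E) :
    ∑ i, |⟪x i, ∑ j, x j⟫| ≤
      ∑ i, ‖x i‖ ^ 2 + ∑ i, ∑ j ∈ Finset.univ.erase i, |⟪x i, x j⟫| := by
  rw [← Finset.sum_add_distrib]
  refine Finset.sum_le_sum fun i _ => ?_
  rw [inner_sum, ← Finset.add_sum_erase _ _ (Finset.mem_univ i), real_inner_self_eq_norm_sq]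
  refine (abs_add_le _ _).trans ?_
  rw [abs_of_nonneg (sq_nonneg _)]
  exact add_le_add le_rfl (Finset.abs_sum_le_sum_abs _ _)

end PairSum

/-- The smallness assumptions relating the scale `w = 1 / √d` of the inner products, the ratio
`η = ℓ / √d`, the norm window `δ`, the bound `β` on the projections and the number `R` of vectors.
All constants are absorbed in `M`; `t` is the threshold. -/
structure SmallRegime (M t w η δ β R : ℝ) : Prop where
  one_le_M : 1 ≤ M
  hazard_le : gaussHazard t ≤ M
  abs_threshold_le : |t| ≤ M
  w_pos : 0 < w
  w_le : w ≤ η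
  δ_nonneg : 0 ≤ δ
  δ_le : δ ≤ η
  δ_sq_le : δ ^ 2 ≤ 9 * M ^ 2 * w
  η_le : η * (100 * M ^ 6) ≤ 1
  one_le_R : 1 ≤ R
  R_mul_le : R * w ≤ M * η
  β_nonneg : 0 ≤ β
  β_sq_le : β ^ 2 ≤ M ^ 2 * η * w

/-- Cliques of the colour given by the sign `σ`, with norms close to one and small projections onto
the spans of the preceding vectors. -/
structure GoodSeq {E : Type*} [NormedAddCommGroup E] [InnerProductSpace ℝ E]
    [FiniteDimensional ℝ E] (σ t w δ β : ℝ) {k : ℕ} (x : Fin k → E) : Prop where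
  clique : ∀ i j, i ≠ j → σ * ⟪x i, x j⟫ ≤ t * w
  norm_window : ∀ i, |‖x i‖ ^ 2 - 1| ≤ δ
  norm_prefixProj_le : ∀ i, ‖prefixProj x i‖ ≤ β

section Regime

variable {M t w η δ β R : ℝ}

namespace SmallRegime

lemma η_nonneg (hr : SmallRegime M t w η δ β R) : 0 ≤ η := hr.w_pos.le.trans hr.w_le

lemma pow_mul_η_le (hr : SmallRegime M t w η δ β R) {m : ℕ} (hm : m ≤ 6) :
    100 * (M ^ m * η) ≤ 1 := by
  have hpow : M ^ m * η ≤ M ^ 6 * η :=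
    mul_le_mul_of_nonneg_right (pow_le_pow_right₀ hr.one_le_M hm) hr.η_nonneg
  linarith [hr.η_le]

lemma η_le_hundredth (hr : SmallRegime M t w η δ β R) : η ≤ 1 / 100 := by
  linarith [hr.pow_mul_η_le (Nat.zero_le 6)]

lemma β_sq_le_η (hr : SmallRegime M t w η δ β R) : β ^ 2 ≤ η := by
  have hMw : M ^ 2 * w ≤ M ^ 2 * η := mul_le_mul_of_nonneg_left hr.w_le (sq_nonneg M)
  have hone : M ^ 2 * w ≤ 1 := by
    linarith [hr.pow_mul_η_le (m := 2) (by norm_num), mul_nonneg (sq_nonneg M) hr.η_nonneg]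
  calc β ^ 2 ≤ M ^ 2 * w * η := hr.β_sq_le.trans_eq (by ring)
    _ ≤ 1 * η := mul_le_mul_of_nonneg_right hone hr.η_nonneg
    _ = η := one_mul η

lemma error_nonneg (hr : SmallRegime M t w η δ β R) : 0 ≤ R ^ 2 * w * η :=
  mul_nonneg (mul_nonneg (sq_nonneg R) hr.w_pos.le) hr.η_nonneg

lemma pow_mul_error_le (hr : SmallRegime M t w η δ β R) {m n : ℕ} (hmn : m ≤ n) :
    M ^ m * (R ^ 2 * w * η) ≤ M ^ n * (R ^ 2 * w * η) :=
  mul_le_mul_of_nonneg_right (pow_le_pow_right₀ hr.one_le_M hmn) hr.error_nonneg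

lemma abs_hazard_mul_le (hr : SmallRegime M t w η δ β R) : |-(gaussHazard t * t)| ≤ M ^ 2 := by
  rw [abs_neg, abs_mul, abs_of_nonneg (gaussHazard_nonneg t), sq]
  exact mul_le_mul hr.hazard_le hr.abs_threshold_le (abs_nonneg t)
    (zero_le_one.trans hr.one_le_M)

lemma mul_β_sq_le (hr : SmallRegime M t w η δ β R) {k : ℝ} (hk : k ≤ R) :
    k * β ^ 2 ≤ M ^ 2 * (R ^ 2 * w * η) := by
  have hR : k ≤ R ^ 2 := hk.trans (by nlinarith [hr.one_le_R])
  calc k * β ^ 2 ≤ R ^ 2 * (M ^ 2 * η * w) :=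
        mul_le_mul hR hr.β_sq_le (sq_nonneg β) (sq_nonneg R)
    _ = M ^ 2 * (R ^ 2 * w * η) := by ring

end SmallRegime

end Regime

section PrefixNorm

variable {E : Type*} [NormedAddCommGroup E] [InnerProductSpace ℝ E] [FiniteDimensional ℝ E] {k : ℕ}

lemma norm_prefixResidual_sq (x : Fin k → E) (i : Fin k) :
    ‖prefixResidual x i‖ ^ 2 = 1 + (‖x i‖ ^ 2 - 1) - ‖prefixProj x i‖ ^ 2 := by
  have hnorm : ‖x i‖ ^ 2 = ‖prefixProj x i + prefixResidual x i‖ ^ 2 := by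
    rw [prefixProj_add_prefixResidual]
  rw [hnorm, norm_add_sq_real, real_inner_comm, inner_prefixResidual_prefixProj]
  ring

lemma prefixResidual_smul {σ : ℝ} (hσ : σ ≠ 0) (x : Fin k → E) (i : Fin k) :
    prefixResidual (fun j => σ • x j) i = σ • prefixResidual x i := by
  have hspan : Submodule.span ℝ ((fun j => σ • x j) '' {j | j < i}) =
      Submodule.span ℝ (x '' {j | j < i}) := by
    rw [← Submodule.span_smul_eq_of_isUnit (x '' _) σ hσ.isUnit]
    exact congrArg _ (Set.image_image (σ • ·) x _).symm
  simp only [prefixResidual, prefixProj, hspan, map_smul, smul_sub]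

lemma norm_prefixResidual_smul {σ : ℝ} (hσ : |σ| = 1) (x : Fin k → E) (i : Fin k) :
    ‖prefixResidual (fun j => σ • x j) i‖ = ‖prefixResidual x i‖ := by
  rw [prefixResidual_smul (abs_ne_zero.1 (by rw [hσ]; exact one_ne_zero)), norm_smul,
    Real.norm_eq_abs, hσ, one_mul]

end PrefixNorm

namespace SmallRegime

variable {M t w η δ β R k lam : ℝ}

lemma M_nonneg (hr : SmallRegime M t w η δ β R) : 0 ≤ M := zero_le_one.trans hr.one_le_M

lemma R_nonneg (hr : SmallRegime M t w η δ β R) : 0 ≤ R := zero_le_one.trans hr.one_le_R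

lemma hazard_sq_le (hr : SmallRegime M t w η δ β R) : gaussHazard t ^ 2 ≤ M ^ 2 :=
  pow_le_pow_left₀ (gaussHazard_nonneg t) hr.hazard_le 2

lemma abs_tilt_mul_w_le (hr : SmallRegime M t w η δ β R) (hlam : |lam| ≤ 2 * M ^ 2 * R) :
    |lam| * w ≤ 2 * (M ^ 3 * η) :=
  calc |lam| * w ≤ 2 * M ^ 2 * R * w := mul_le_mul_of_nonneg_right hlam hr.w_pos.le
    _ = 2 * M ^ 2 * (R * w) := by ring
    _ ≤ 2 * M ^ 2 * (M * η) := mul_le_mul_of_nonneg_left hr.R_mul_le (by positivity)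
    _ = 2 * (M ^ 3 * η) := by ring

lemma mul_sq_tilt_le (hr : SmallRegime M t w η δ β R) (hk : k ≤ R)
    (hlam : |lam| ≤ 2 * M ^ 2 * R) : k * (w * lam) ^ 2 ≤ 4 * (M ^ 5 * (R ^ 2 * w * η)) := by
  have hR := hr.R_nonneg
  have hw := hr.w_pos.le
  calc k * (w * lam) ^ 2 = k * |lam| * (|lam| * w) * w := by
        rw [mul_pow, ← sq_abs lam]
        ring
    _ ≤ R * (2 * M ^ 2 * R) * (2 * (M ^ 3 * η)) * w := by
        have := hr.abs_tilt_mul_w_le hlam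
        gcongr
    _ = 4 * (M ^ 5 * (R ^ 2 * w * η)) := by ring

lemma hazard_mul_tilt_mul_le (hr : SmallRegime M t w η δ β R) (hk0 : 0 ≤ k) (hk : k ≤ R)
    (hlam : |lam| ≤ 2 * M ^ 2 * R) :
    gaussHazard t * |lam| * w * η * k ≤ 2 * (M ^ 3 * (R ^ 2 * w * η)) := by
  have hR := hr.R_nonneg
  have hη := hr.η_nonneg
  have hw := hr.w_pos.le
  have hM := hr.M_nonneg
  calc gaussHazard t * |lam| * w * η * k ≤ M * (2 * M ^ 2 * R) * w * η * R := by
        have := hr.hazard_le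
        gcongr
    _ = 2 * (M ^ 3 * (R ^ 2 * w * η)) := by ring

lemma mul_w_le_one (hr : SmallRegime M t w η δ β R) (hk : k ≤ R) : k * w ≤ 1 := by
  have hη := hr.pow_mul_η_le (m := 1) (by norm_num)
  rw [pow_one] at hη
  linarith [mul_le_mul_of_nonneg_right hk hr.w_pos.le, hr.R_mul_le,
    mul_nonneg hr.M_nonneg hr.η_nonneg]

lemma hazard_mul_tilt_nonneg (hr : SmallRegime M t w η δ β R) (lam : ℝ) :
    0 ≤ gaussHazard t * |lam| * w * η :=
  mul_nonneg (mul_nonneg (mul_nonneg (gaussHazard_nonneg t) (abs_nonneg _)) hr.w_pos.le) hr.η_nonneg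

lemma hazard_mul_tilt_mul_sq_le (hr : SmallRegime M t w η δ β R) (hk0 : 0 ≤ k) (hk : k ≤ R)
    (hlam : |lam| ≤ 2 * M ^ 2 * R) :
    gaussHazard t * |lam| * w * η * (M * w * k ^ 2) ≤ 2 * (M ^ 4 * (R ^ 2 * w * η)) := by
  have hM := hr.M_nonneg
  calc _ = gaussHazard t * |lam| * w * η * k * M * (k * w) := by ring
    _ ≤ gaussHazard t * |lam| * w * η * k * M * 1 := mul_le_mul_of_nonneg_left
        (hr.mul_w_le_one hk) (mul_nonneg (mul_nonneg (hr.hazard_mul_tilt_nonneg lam) hk0) hM)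
    _ ≤ 2 * (M ^ 3 * (R ^ 2 * w * η)) * M * 1 := by
        have := hr.hazard_mul_tilt_mul_le hk0 hk hlam
        gcongr
    _ = 2 * (M ^ 4 * (R ^ 2 * w * η)) := by ring

end SmallRegime

namespace GoodSeq

variable {E : Type*} [NormedAddCommGroup E] [InnerProductSpace ℝ E] [FiniteDimensional ℝ E]
  {M σ t w η δ β R lam κ : ℝ} {k : ℕ} {x : Fin k → E}

lemma norm_prefixProj_sq_le (hx : GoodSeq σ t w δ β x) (i : Fin k) :
    ‖prefixProj x i‖ ^ 2 ≤ β ^ 2 :=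
  pow_le_pow_left₀ (norm_nonneg _) (hx.norm_prefixProj_le i) 2

lemma three_quarters_le_norm_prefixResidual (hr : SmallRegime M t w η δ β R)
    (hx : GoodSeq σ t w δ β x) (i : Fin k) : 3 / 4 ≤ ‖prefixResidual x i‖ :=
  three_quarters_le_of_sq_eq (norm_nonneg _) (norm_prefixResidual_sq x i)
    ((hx.norm_window i).trans hr.δ_le) ((hx.norm_prefixProj_sq_le i).trans hr.β_sq_le_η)
    (hr.η_le_hundredth.trans (by norm_num))

lemma norm_prefixResidual_pos (hr : SmallRegime M t w η δ β R) (hx : GoodSeq σ t w δ β x)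
    (i : Fin k) : 0 < ‖prefixResidual x i‖ := by
  linarith [hx.three_quarters_le_norm_prefixResidual hr i]

lemma inv_norm_prefixResidual_le (hr : SmallRegime M t w η δ β R) (hx : GoodSeq σ t w δ β x)
    (i : Fin k) : ‖prefixResidual x i‖⁻¹ ≤ 2 := by
  rw [inv_le_comm₀ (hx.norm_prefixResidual_pos hr i) two_pos]
  linarith [hx.three_quarters_le_norm_prefixResidual hr i]

lemma abs_inv_norm_prefixResidual_sub_one_le (hr : SmallRegime M t w η δ β R)
    (hx : GoodSeq σ t w δ β x) (i : Fin k) : |‖prefixResidual x i‖⁻¹ - 1| ≤ 4 * η :=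
  abs_inv_sub_one_le (norm_nonneg _) (norm_prefixResidual_sq x i)
    ((hx.norm_window i).trans hr.δ_le) (sq_nonneg _)
    ((hx.norm_prefixProj_sq_le i).trans hr.β_sq_le_η) (hr.η_le_hundredth.trans (by norm_num))

lemma sum_norm_sq_le (hr : SmallRegime M t w η δ β R) (hx : GoodSeq σ t w δ β x) :
    ∑ i, ‖x i‖ ^ 2 ≤ 2 * k := by
  have hsum := (abs_le.1 (abs_sum_norm_sq_sub_card_le hx.norm_window)).2
  have hδ : δ ≤ 1 := hr.δ_le.trans (hr.η_le_hundredth.trans (by norm_num))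
  rw [Fintype.card_fin] at hsum
  linarith [mul_le_mul_of_nonneg_left hδ (Nat.cast_nonneg (α := ℝ) k)]

lemma tilt_norm_sq_le (hr : SmallRegime M t w η δ β R) (hx : GoodSeq σ t w δ β x)
    (hk : (k : ℝ) ≤ R) (hlam : |lam| ≤ 2 * M ^ 2 * R) (hκ : κ ^ 2 ≤ 2) :
    κ ^ 2 * ‖w • lam • ∑ i, x i‖ ^ 2 / 2 ≤
      2 * (w * lam) ^ 2 * pairSum x + 8 * (M ^ 5 * (R ^ 2 * w * η)) := by
  have hsum : ‖∑ i, x i‖ ^ 2 ≤ 2 * k + 2 * pairSum x := by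
    rw [norm_sq_sum_eq]
    linarith [hx.sum_norm_sq_le hr]
  calc κ ^ 2 * ‖w • lam • ∑ i, x i‖ ^ 2 / 2 = κ ^ 2 * ((w * lam) ^ 2 * ‖∑ i, x i‖ ^ 2) / 2 := by
        rw [smul_smul, norm_smul, mul_pow, Real.norm_eq_abs, sq_abs]
    _ ≤ 2 * ((w * lam) ^ 2 * ‖∑ i, x i‖ ^ 2) / 2 := by gcongr
    _ ≤ 2 * ((w * lam) ^ 2 * (2 * k + 2 * pairSum x)) / 2 := by gcongr
    _ = 2 * (w * lam) ^ 2 * pairSum x + 2 * (k * (w * lam) ^ 2) := by ring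
    _ ≤ _ := by linarith [hr.mul_sq_tilt_le hk hlam]

lemma hazard_mul_threshold_le (hr : SmallRegime M t w η δ β R) (hx : GoodSeq σ t w δ β x)
    (hκ : κ ≠ 0) (i : Fin k) :
    gaussHazard t * (t / κ / ‖prefixResidual x i‖ - t) ≤
      normPotential (M ^ 2) (-(gaussHazard t * t)) (‖x i‖ ^ 2 - 1) + 5 * M ^ 2 * β ^ 2 +
        2 * M ^ 2 * |1 - κ⁻¹| := by
  have hLpos := hx.norm_prefixResidual_pos hr i
  have hproj : ‖prefixProj x i‖ ^ 2 ≤ 1 := by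
    linarith [hx.norm_prefixProj_sq_le i, hr.β_sq_le_η, hr.η_le_hundredth]
  have hpotential := mul_one_sub_inv_le_normPotential hr.abs_hazard_mul_le
    (by linarith [hx.three_quarters_le_norm_prefixResidual hr i]) (norm_prefixResidual_sq x i)
    (sq_nonneg _) hproj
  have hrescaling : -(gaussHazard t * t) * ‖prefixResidual x i‖⁻¹ * (1 - κ⁻¹) ≤
      2 * M ^ 2 * |1 - κ⁻¹| :=
    calc _ ≤ |-(gaussHazard t * t)| * ‖prefixResidual x i‖⁻¹ * |1 - κ⁻¹| := by
          refine (le_abs_self _).trans_eq ?_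
          rw [abs_mul, abs_mul, abs_of_pos (inv_pos.2 hLpos)]
      _ ≤ M ^ 2 * 2 * |1 - κ⁻¹| := by
          have := hr.abs_hazard_mul_le
          have := hx.inv_norm_prefixResidual_le hr i
          gcongr
      _ = _ := by ring
  have hsplit : gaussHazard t * (t / κ / ‖prefixResidual x i‖ - t) =
      -(gaussHazard t * t) * (1 - ‖prefixResidual x i‖⁻¹) +
        -(gaussHazard t * t) * ‖prefixResidual x i‖⁻¹ * (1 - κ⁻¹) := by
    field_simp
    ring
  have hβ : 5 * M ^ 2 * ‖prefixProj x i‖ ^ 2 ≤ 5 * M ^ 2 * β ^ 2 :=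
    mul_le_mul_of_nonneg_left (hx.norm_prefixProj_sq_le i) (by positivity)
  linarith

lemma sum_hazard_mul_threshold_le (hr : SmallRegime M t w η δ β R) (hx : GoodSeq σ t w δ β x)
    (hk : (k : ℝ) ≤ R) (hκ : κ ≠ 0) :
    gaussHazard t * ∑ i, (t / κ / ‖prefixResidual x i‖ - t) ≤
      ∑ i, normPotential (M ^ 2) (-(gaussHazard t * t)) (‖x i‖ ^ 2 - 1) +
        5 * (M ^ 4 * (R ^ 2 * w * η)) + 2 * k * M ^ 2 * |1 - κ⁻¹| := by
  have hsum := Finset.sum_le_sum fun i (_ : i ∈ Finset.univ) => hx.hazard_mul_threshold_le hr hκ i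
  simp only [← Finset.mul_sum, Finset.sum_add_distrib, Finset.sum_const, Finset.card_univ,
    Fintype.card_fin, nsmul_eq_mul] at hsum
  have hβ := mul_le_mul_of_nonneg_left (hr.mul_β_sq_le hk) (sq_nonneg M)
  linarith

lemma interaction_le (hr : SmallRegime M t w η δ β R) (hx : GoodSeq σ t w δ β x) (hσ : |σ| = 1)
    (hκ : |κ - 1| ≤ 4 * η) (y : E) (i : Fin k) :
    gaussHazard t * (-(κ * ⟪σ • x i, w • lam • y⟫) / ‖prefixResidual x i‖) ≤
      -σ * gaussHazard t * lam * w * ⟪x i, y⟫ +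
        10 * (gaussHazard t * |lam| * w * η) * |⟪x i, y⟫| := by
  have hratio : |κ * ‖prefixResidual x i‖⁻¹ - 1| ≤ 10 * η :=
    abs_mul_sub_one_le hκ (hx.abs_inv_norm_prefixResidual_sub_one_le hr i)
      (hr.η_le_hundredth.trans (by norm_num))
  have hsplit : gaussHazard t * (-(κ * ⟪σ • x i, w • lam • y⟫) / ‖prefixResidual x i‖) =
      -σ * gaussHazard t * lam * w * ⟪x i, y⟫ +
        -(σ * gaussHazard t * lam * w * ⟪x i, y⟫ * (κ * ‖prefixResidual x i‖⁻¹ - 1)) := by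
    simp only [real_inner_smul_left, real_inner_smul_right]
    field_simp
    ring
  rw [hsplit]
  refine add_le_add le_rfl ((neg_le_abs _).trans ?_)
  simp only [abs_mul, hσ, abs_of_nonneg (gaussHazard_nonneg t), abs_of_pos hr.w_pos, one_mul]
  have hnonneg : 0 ≤ gaussHazard t * |lam| * w * |⟪x i, y⟫| :=
    mul_nonneg (mul_nonneg (mul_nonneg (gaussHazard_nonneg t) (abs_nonneg _)) hr.w_pos.le)
      (abs_nonneg _)
  linarith [mul_le_mul_of_nonneg_left hratio hnonneg]

lemma sum_interaction_le (hr : SmallRegime M t w η δ β R) (hx : GoodSeq σ t w δ β x)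
    (hσ : |σ| = 1) (hk : (k : ℝ) ≤ R) (hlam : |lam| ≤ 2 * M ^ 2 * R) (hκ : |κ - 1| ≤ 4 * η) :
    gaussHazard t * ∑ i, (-(κ * ⟪σ • x i, w • lam • ∑ j, x j⟫) / ‖prefixResidual x i‖) ≤
      -σ * gaussHazard t * lam * w * k +
        (-2 * σ * gaussHazard t * lam * w - 20 * σ * gaussHazard t * |lam| * w * η) * pairSum x +
        82 * (M ^ 5 * (R ^ 2 * w * η)) := by
  have hsum := Finset.sum_le_sum fun i (_ : i ∈ Finset.univ) =>
    hx.interaction_le hr hσ (lam := lam) hκ (∑ j, x j) i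
  rw [Finset.sum_add_distrib, ← Finset.mul_sum, ← Finset.mul_sum, ← Finset.mul_sum, ← sum_inner,
    real_inner_self_eq_norm_sq, norm_sq_sum_eq] at hsum
  have habs : ∑ i, |⟪x i, ∑ j, x j⟫| ≤ 2 * k + (-2 * σ * pairSum x + 2 * M * w * k ^ 2) := by
    have hpairs := sum_sum_abs_inner_le hσ hr.w_pos.le hr.abs_threshold_le hx.clique
    rw [Fintype.card_fin] at hpairs
    exact (sum_abs_inner_sum_le x).trans (add_le_add (hx.sum_norm_sq_le hr) hpairs)
  have herror := hr.hazard_mul_tilt_mul_le (Nat.cast_nonneg k) hk hlam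
  have hwindow : -σ * gaussHazard t * lam * w * (∑ i, ‖x i‖ ^ 2 - k) ≤
      gaussHazard t * |lam| * w * η * k := by
    have hN := (abs_sum_norm_sq_sub_card_le hx.norm_window).trans
      (mul_le_mul_of_nonneg_left hr.δ_le (Nat.cast_nonneg _))
    rw [Fintype.card_fin] at hN
    refine (le_abs_self _).trans ?_
    simp only [abs_mul, abs_neg, hσ, abs_of_nonneg (gaussHazard_nonneg t), abs_of_pos hr.w_pos,
      one_mul]
    have hnonneg : 0 ≤ gaussHazard t * |lam| * w := mul_nonneg
      (mul_nonneg (gaussHazard_nonneg t) (abs_nonneg _)) hr.w_pos.le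
    linarith [mul_le_mul_of_nonneg_left hN hnonneg]
  have hquadratic := hr.hazard_mul_tilt_mul_sq_le (Nat.cast_nonneg k) hk hlam
  have h34 := hr.pow_mul_error_le (m := 3) (n := 5) (by norm_num)
  have h45 := hr.pow_mul_error_le (m := 4) (n := 5) (by norm_num)
  linarith [mul_le_mul_of_nonneg_left habs (hr.hazard_mul_tilt_nonneg lam)]

lemma sum_normalized_norm_sq_le (hr : SmallRegime M t w η δ β R) (hx : GoodSeq σ t w δ β x)
    (hσ : |σ| = 1) :
    ∑ i, (‖prefixResidual x i‖⁻¹ * σ) ^ 2 * ‖x i‖ ^ 2 ≤ k + 4 * (k * β ^ 2) := by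
  have hterm : ∀ i, (‖prefixResidual x i‖⁻¹ * σ) ^ 2 * ‖x i‖ ^ 2 ≤ 1 + 4 * β ^ 2 := by
    intro i
    have hL := (hx.norm_prefixResidual_pos hr i).ne'
    have hinv : ‖prefixResidual x i‖⁻¹ ^ 2 ≤ 2 ^ 2 := pow_le_pow_left₀
      (inv_nonneg.2 (norm_nonneg _)) (hx.inv_norm_prefixResidual_le hr i) 2
    calc (‖prefixResidual x i‖⁻¹ * σ) ^ 2 * ‖x i‖ ^ 2 =
          ‖prefixResidual x i‖⁻¹ ^ 2 * (‖prefixResidual x i‖ ^ 2 + ‖prefixProj x i‖ ^ 2) := by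
          rw [mul_pow, ← sq_abs σ, hσ, norm_prefixResidual_sq]
          ring
      _ = 1 + ‖prefixResidual x i‖⁻¹ ^ 2 * ‖prefixProj x i‖ ^ 2 := by field_simp
      _ ≤ 1 + 2 ^ 2 * β ^ 2 := by
          have := hx.norm_prefixProj_sq_le i
          gcongr
      _ = 1 + 4 * β ^ 2 := by norm_num
  refine (Finset.sum_le_sum fun i _ => hterm i).trans_eq ?_
  rw [Finset.sum_const, Finset.card_univ, Fintype.card_fin, nsmul_eq_mul]
  ring

lemma sum_normalized_inner_le (hr : SmallRegime M t w η δ β R) (hx : GoodSeq σ t w δ β x)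
    (hσ : |σ| = 1) :
    ∑ i, ∑ j ∈ Finset.univ.erase i,
      ‖prefixResidual x i‖⁻¹ * σ * (‖prefixResidual x j‖⁻¹ * σ) * ⟪x i, x j⟫ ≤
        2 * pairSum x + 10 * η * ∑ i, ∑ j ∈ Finset.univ.erase i, |⟪x i, x j⟫| := by
  have hσ2 : σ ^ 2 = 1 := by rw [← sq_abs, hσ, one_pow]
  simp only [two_mul_pairSum, Finset.mul_sum, ← Finset.sum_add_distrib]
  refine Finset.sum_le_sum fun i _ => Finset.sum_le_sum fun j _ => ?_
  have hratio := abs_mul_sub_one_le (hx.abs_inv_norm_prefixResidual_sub_one_le hr i)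
    (hx.abs_inv_norm_prefixResidual_sub_one_le hr j) (hr.η_le_hundredth.trans (by norm_num))
  calc ‖prefixResidual x i‖⁻¹ * σ * (‖prefixResidual x j‖⁻¹ * σ) * ⟪x i, x j⟫ =
        ⟪x i, x j⟫ + (‖prefixResidual x i‖⁻¹ * ‖prefixResidual x j‖⁻¹ - 1) * ⟪x i, x j⟫ := by
        linear_combination ‖prefixResidual x i‖⁻¹ * ‖prefixResidual x j‖⁻¹ * ⟪x i, x j⟫ * hσ2
    _ ≤ ⟪x i, x j⟫ + 10 * η * |⟪x i, x j⟫| := by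
        refine add_le_add le_rfl ((le_abs_self _).trans ?_)
        rw [abs_mul]
        exact mul_le_mul_of_nonneg_right hratio (abs_nonneg _)

lemma norm_sq_sum_normalized_le (hr : SmallRegime M t w η δ β R) (hx : GoodSeq σ t w δ β x)
    (hσ : |σ| = 1) :
    ‖∑ i, ‖prefixResidual x i‖⁻¹ • σ • x i‖ ^ 2 - k ≤
      4 * (k * β ^ 2) + (2 - 20 * σ * η) * pairSum x + 20 * η * M * w * k ^ 2 := by
  have hpairs := sum_sum_abs_inner_le hσ hr.w_pos.le hr.abs_threshold_le hx.clique
  rw [Fintype.card_fin] at hpairs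
  simp only [smul_smul]
  rw [norm_sq_sum_smul]
  linarith [hx.sum_normalized_norm_sq_le hr hσ, hx.sum_normalized_inner_le hr hσ,
    mul_le_mul_of_nonneg_left hpairs (mul_nonneg (by norm_num : (0 : ℝ) ≤ 10) hr.η_nonneg)]

lemma hazard_sq_mul_norm_sq_le (hr : SmallRegime M t w η δ β R) (hx : GoodSeq σ t w δ β x)
    (hσ : |σ| = 1) (hk : (k : ℝ) ≤ R) :
    gaussHazard t ^ 2 / 2 * (‖∑ i, ‖prefixResidual x i‖⁻¹ • σ • x i‖ ^ 2 - k) ≤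
      (gaussHazard t ^ 2 - 10 * σ * gaussHazard t ^ 2 * η) * pairSum x +
        12 * (M ^ 4 * (R ^ 2 * w * η)) := by
  have hhM := hr.hazard_sq_le
  have hdiag : gaussHazard t ^ 2 * (k * β ^ 2) ≤ M ^ 4 * (R ^ 2 * w * η) :=
    calc gaussHazard t ^ 2 * (k * β ^ 2) ≤ M ^ 2 * (M ^ 2 * (R ^ 2 * w * η)) := by
          have := hr.mul_β_sq_le hk
          gcongr
      _ = M ^ 4 * (R ^ 2 * w * η) := by ring
  have hoff : gaussHazard t ^ 2 * (η * M * w * k ^ 2) ≤ M ^ 3 * (R ^ 2 * w * η) :=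
    calc gaussHazard t ^ 2 * (η * M * w * k ^ 2) ≤ M ^ 2 * (η * M * w * R ^ 2) := by
          have := hr.w_pos.le
          have := hr.η_nonneg
          have := hr.M_nonneg
          gcongr
      _ = M ^ 3 * (R ^ 2 * w * η) := by ring
  have h34 := hr.pow_mul_error_le (m := 3) (n := 4) (by norm_num)
  have hquadratic := mul_le_mul_of_nonneg_left (hx.norm_sq_sum_normalized_le hr hσ)
    (by positivity : 0 ≤ gaussHazard t ^ 2 / 2)
  linarith

end GoodSeq

/-! ### Integrating out one vector -/

/-- The increase of the coefficient `lam` of the pair sum in the exponent when one vector is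
integrated out: the terms come from completing the square, from the shift of the thresholds by the
tilt, and from the quadratic form of the truncated Gaussian. -/
noncomputable def tiltIncrement (σ t w η lam : ℝ) : ℝ :=
  2 * (w * lam) ^ 2 - 2 * σ * gaussHazard t * lam * w - 20 * σ * gaussHazard t * |lam| * w * η +
    (gaussHazard t ^ 2 - 10 * σ * gaussHazard t ^ 2 * η)

/-- The coefficient of the pair sum of the remaining vectors after `n` vectors have been integrated
out; it is close to `n * gaussHazard t ^ 2`. -/
noncomputable def tiltCoeff (σ t w η : ℝ) : ℕ → ℝ
  | 0 => 0
  | n + 1 => tiltCoeff σ t w η n + tiltIncrement σ t w η (tiltCoeff σ t w η n)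

namespace SmallRegime

variable {M σ t w η δ β R lam : ℝ} {n : ℕ}

lemma abs_tiltIncrement_sub_le (hr : SmallRegime M t w η δ β R) (hσ : |σ| = 1)
    (hlam : |lam| ≤ 2 * M ^ 2 * R) :
    |tiltIncrement σ t w η lam - gaussHazard t ^ 2| ≤ 16 * (M ^ 6 * η) := by
  have hM := hr.one_le_M
  have hη := hr.η_nonneg
  have hw := hr.w_pos.le
  have hη' := hr.η_le_hundredth
  have hhM := hr.hazard_le
  have hlw := hr.abs_tilt_mul_w_le hlam
  have h26 : M ^ 2 * η ≤ M ^ 6 * η := by gcongr; norm_num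
  have h46 : M ^ 4 * η ≤ M ^ 6 * η := by gcongr; norm_num
  have hsquare : 2 * (w * lam) ^ 2 ≤ M ^ 6 * η :=
    calc 2 * (w * lam) ^ 2 = 2 * (|lam| * w) ^ 2 := by
          rw [mul_pow, mul_pow, sq_abs, mul_comm (w ^ 2)]
      _ ≤ 2 * (2 * (M ^ 3 * η)) ^ 2 := by gcongr
      _ = 8 * η * (M ^ 6 * η) := by ring
      _ ≤ 1 * (M ^ 6 * η) := mul_le_mul_of_nonneg_right (by linarith) (by positivity)
      _ = M ^ 6 * η := one_mul _
  have hshift : gaussHazard t * |lam| * w ≤ 2 * (M ^ 4 * η) :=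
    calc gaussHazard t * |lam| * w = gaussHazard t * (|lam| * w) := by ring
      _ ≤ M * (2 * (M ^ 3 * η)) := by gcongr
      _ = 2 * (M ^ 4 * η) := by ring
  have hshiftError := hr.hazard_mul_tilt_nonneg lam
  have hshiftError' : gaussHazard t * |lam| * w * η ≤ 2 * (M ^ 4 * η) * (1 / 100) := by gcongr
  have hquadratic : gaussHazard t ^ 2 * η ≤ M ^ 2 * η :=
    mul_le_mul_of_nonneg_right hr.hazard_sq_le hη
  have hquadratic_nonneg : 0 ≤ gaussHazard t ^ 2 * η := mul_nonneg (sq_nonneg _) hη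
  have hsigned : |gaussHazard t * lam * w| ≤ 2 * (M ^ 4 * η) := by
    rwa [abs_mul, abs_mul, abs_of_nonneg (gaussHazard_nonneg t), abs_of_nonneg hw]
  have hM6 : 0 ≤ M ^ 6 * η := by positivity
  rw [abs_le] at hsigned ⊢
  rw [tiltIncrement]
  rcases eq_or_eq_neg_of_abs_eq hσ with rfl | rfl <;>
    constructor <;> linarith [sq_nonneg (w * lam)]

lemma abs_le_of_abs_sub_le (hr : SmallRegime M t w η δ β R) (hn : (n : ℝ) ≤ R)
    (hlam : |lam - n * gaussHazard t ^ 2| ≤ 16 * (M ^ 6 * η) * n) : |lam| ≤ 2 * M ^ 2 * R := by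
  have hη := hr.pow_mul_η_le le_rfl
  have hn0 : (0 : ℝ) ≤ n := n.cast_nonneg
  have hM2 : 1 ≤ M ^ 2 := one_le_pow₀ hr.one_le_M
  have herror : 16 * (M ^ 6 * η) * n ≤ M ^ 2 * R := mul_le_mul
    (by linarith [mul_nonneg (pow_nonneg hr.M_nonneg 6) hr.η_nonneg]) hn hn0 (by positivity)
  have hmain : n * gaussHazard t ^ 2 ≤ R * M ^ 2 :=
    mul_le_mul hn hr.hazard_sq_le (sq_nonneg _) hr.R_nonneg
  have hmain_nonneg : 0 ≤ n * gaussHazard t ^ 2 := mul_nonneg hn0 (sq_nonneg _)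
  rw [abs_le] at hlam ⊢
  constructor <;> linarith

lemma abs_tiltCoeff_sub_le (hr : SmallRegime M t w η δ β R) (hσ : |σ| = 1) (hn : (n : ℝ) ≤ R) :
    |tiltCoeff σ t w η n - n * gaussHazard t ^ 2| ≤ 16 * (M ^ 6 * η) * n := by
  induction n with
  | zero => simp [tiltCoeff]
  | succ n ih =>
    push_cast at hn ⊢
    have hn' : (n : ℝ) ≤ R := by linarith
    calc |tiltCoeff σ t w η (n + 1) - (n + 1) * gaussHazard t ^ 2|
        = |(tiltCoeff σ t w η n - n * gaussHazard t ^ 2) +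
            (tiltIncrement σ t w η (tiltCoeff σ t w η n) - gaussHazard t ^ 2)| := by
          rw [tiltCoeff]
          ring_nf
      _ ≤ 16 * (M ^ 6 * η) * n + 16 * (M ^ 6 * η) := (abs_add_le _ _).trans <|
          add_le_add (ih hn') <|
            hr.abs_tiltIncrement_sub_le hσ (hr.abs_le_of_abs_sub_le hn' (ih hn'))
      _ = 16 * (M ^ 6 * η) * (n + 1) := by ring

lemma abs_tiltCoeff_le (hr : SmallRegime M t w η δ β R) (hσ : |σ| = 1) (hn : (n : ℝ) ≤ R) :
    |tiltCoeff σ t w η n| ≤ 2 * M ^ 2 * R :=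
  hr.abs_le_of_abs_sub_le hn (hr.abs_tiltCoeff_sub_le hσ hn)

lemma neg_hazard_mul_tiltCoeff_le {k : ℝ} (hr : SmallRegime M t w η δ β R) (hσ : |σ| = 1)
    (hn : (n : ℝ) ≤ R) (hk0 : 0 ≤ k) (hk : k ≤ R) :
    -σ * gaussHazard t * tiltCoeff σ t w η n * w * k ≤
      -σ * gaussHazard t ^ 3 * w * (n * k) + 16 * (M ^ 7 * (R ^ 2 * w * η)) := by
  have hη := hr.η_nonneg
  have hM := hr.M_nonneg
  have hw := hr.w_pos.le
  have hR := hr.R_nonneg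
  have hcoeff : |tiltCoeff σ t w η n - n * gaussHazard t ^ 2| ≤ 16 * (M ^ 6 * η) * R :=
    (hr.abs_tiltCoeff_sub_le hσ hn).trans (by gcongr)
  have herror : -σ * gaussHazard t * (tiltCoeff σ t w η n - n * gaussHazard t ^ 2) * w * k ≤
      16 * (M ^ 7 * (R ^ 2 * w * η)) :=
    calc _ ≤ gaussHazard t * |tiltCoeff σ t w η n - n * gaussHazard t ^ 2| * w * k := by
          refine (le_abs_self _).trans_eq ?_
          simp only [abs_mul, abs_neg, hσ, abs_of_nonneg (gaussHazard_nonneg t), abs_of_nonneg hw,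
            abs_of_nonneg hk0, one_mul]
      _ ≤ M * (16 * (M ^ 6 * η) * R) * w * R := by
          have := hr.hazard_le
          gcongr
      _ = _ := by ring
  linarith

end SmallRegime

namespace GoodSeq

variable {E : Type*} [NormedAddCommGroup E] [InnerProductSpace ℝ E] [FiniteDimensional ℝ E]
  {M σ t w η δ β R lam κ χ θ : ℝ} {k : ℕ} {x : Fin k → E}

lemma tilted_exponent_le (hr : SmallRegime M t w η δ β R) (hx : GoodSeq σ t w δ β x)
    (hσ : |σ| = 1) (hk : (k : ℝ) ≤ R) (hlam : |lam| ≤ 2 * M ^ 2 * R) (hκ : 0 < κ)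
    (hχ : χ = 1 - (κ ^ 2)⁻¹) (hχη : |χ| ≤ 4 * η) :
    κ ^ 2 * ‖w • lam • ∑ i, x i‖ ^ 2 / 2 +
        gaussHazard t * ∑ i, ((t / κ - κ * ⟪σ • x i, w • lam • ∑ j, x j⟫) /
          ‖prefixResidual x i‖ - t) +
        gaussHazard t ^ 2 / 2 * (‖∑ i, ‖prefixResidual x i‖⁻¹ • σ • x i‖ ^ 2 - k) ≤
      -σ * gaussHazard t * lam * w * k +
        ∑ i, normPotential (M ^ 2) (-(gaussHazard t * t)) (‖x i‖ ^ 2 - 1) +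
        tiltIncrement σ t w η lam * pairSum x + 107 * (M ^ 5 * (R ^ 2 * w * η)) +
        2 * k * M ^ 2 * |χ| := by
  have hχ' : |χ| ≤ 1 / 2 := by linarith [hr.η_le_hundredth]
  have htilt := hx.tilt_norm_sq_le hr hk hlam (sq_le_two_of_eq_one_sub_inv_sq hχ hχ')
  have hthreshold := hx.sum_hazard_mul_threshold_le hr hk hκ.ne'
  have hinteraction := hx.sum_interaction_le hr hσ hk hlam
    ((abs_sub_one_le_of_eq_one_sub_inv_sq hκ hχ hχ').trans hχη)
  have hform := hx.hazard_sq_mul_norm_sq_le hr hσ hk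
  have hsplit : ∑ i, ((t / κ - κ * ⟪σ • x i, w • lam • ∑ j, x j⟫) / ‖prefixResidual x i‖ - t) =
      ∑ i, (t / κ / ‖prefixResidual x i‖ - t) +
        ∑ i, (-(κ * ⟪σ • x i, w • lam • ∑ j, x j⟫) / ‖prefixResidual x i‖) := by
    rw [← Finset.sum_add_distrib]
    exact Finset.sum_congr rfl fun i _ => by ring
  have hrescaling : 2 * k * M ^ 2 * |1 - κ⁻¹| ≤ 2 * k * M ^ 2 * |χ| :=
    mul_le_mul_of_nonneg_left (abs_one_sub_inv_le_of_eq_one_sub_inv_sq hκ hχ) (by positivity)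
  have h45 := hr.pow_mul_error_le (m := 4) (n := 5) (by norm_num)
  rw [hsplit, tiltIncrement]
  linarith

variable [MeasurableSpace E] [BorelSpace E]

lemma setLIntegral_exp_tilt_le (hr : SmallRegime M t w η δ β R) (hx : GoodSeq σ t w δ β x)
    (hσ : |σ| = 1) (hk : (k : ℝ) ≤ R) (hlam : |lam| ≤ 2 * M ^ 2 * R)
    (hd : (Module.finrank ℝ E : ℝ) * w ^ 2 = 1) (hθ : |2 * θ * w ^ 2| ≤ 4 * η) :
    ∫⁻ g in orthant (fun i => σ • x i) fun _ => t * w,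
        ENNReal.ofReal (Real.exp (⟪lam • ∑ i, x i, g⟫ + θ * (‖g‖ ^ 2 - 1)))
        ∂((stdGaussian E).map (w • ·)) ≤
      ENNReal.ofReal (gaussCDF t ^ k * Real.exp (-σ * gaussHazard t * lam * w * k +
        ∑ i, normPotential (M ^ 2) (-(gaussHazard t * t)) (‖x i‖ ^ 2 - 1) +
        tiltIncrement σ t w η lam * pairSum x + 107 * (M ^ 5 * (R ^ 2 * w * η)) +
        2 * k * M ^ 2 * |2 * θ * w ^ 2| + 2 * θ ^ 2 * w ^ 2)) := by
  have hθ' : |2 * θ * w ^ 2| ≤ 1 / 2 := by linarith [hr.η_le_hundredth]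
  obtain ⟨κ, hκ, hθκ⟩ := exists_pos_eq_one_sub_inv_sq
    (by linarith [(abs_le.1 hθ').2] : 2 * θ * w ^ 2 < 1)
  refine (setLIntegral_orthant_exp_tilt_le hr.w_pos hκ hθκ t (fun i => σ • x i) (lam • ∑ i, x i)
    fun i => ?_).trans (ENNReal.ofReal_le_ofReal ?_)
  · rw [norm_prefixResidual_smul hσ]
    exact hx.norm_prefixResidual_pos hr i
  simp only [norm_prefixResidual_smul hσ]
  have hq : 0 ≤ gaussCDF t ^ k := pow_nonneg (gaussCDF_pos t).le k
  calc _ ≤ Real.exp (2 * θ ^ 2 * w ^ 2) * gaussCDF t ^ k * Real.exp _ :=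
        mul_le_mul (mul_le_mul_of_nonneg_right (exp_neg_mul_pow_le hd hθκ hθ') hq)
          (Real.exp_le_exp.2 (hx.tilted_exponent_le hr hσ hk hlam hκ hθκ hθ))
          (Real.exp_pos _).le (mul_nonneg (Real.exp_pos _).le hq)
    _ = _ := by
        rw [Real.exp_add _ (2 * θ ^ 2 * w ^ 2)]
        ring

end GoodSeq

lemma exp_add_le_exp_add {a b : ℝ} (ha : 0 ≤ a) (hb : 0 ≤ b) :
    Real.exp a + b ≤ Real.exp (a + b) :=
  calc Real.exp a + b ≤ Real.exp a + Real.exp a * b := by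
        linarith [le_mul_of_one_le_left hb (Real.one_le_exp ha)]
    _ = Real.exp a * (b + 1) := by ring
    _ ≤ Real.exp a * Real.exp b :=
        mul_le_mul_of_nonneg_left (Real.add_one_le_exp b) (Real.exp_pos a).le
    _ = Real.exp (a + b) := (Real.exp_add a b).symm

lemma setLIntegral_exp_normPotential_le {E : Type*} [NormedAddCommGroup E] [InnerProductSpace ℝ E]
    [MeasurableSpace E] [BorelSpace E] (μ : Measure E) {A : Set E} (hA : MeasurableSet A) (v : E)
    {B w n : ℝ} (b : ℝ) (hB : 0 ≤ B) (hw : 0 < w) (hn : 0 ≤ n)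
    (hs : ∀ g ∈ A, n * (4 * B * (‖g‖ ^ 2 - 1) ^ 2) ≤ 1) :
    ∫⁻ g in A, ENNReal.ofReal (Real.exp (⟪v, g⟫ + n * normPotential B b (‖g‖ ^ 2 - 1))) ∂μ ≤
      ∫⁻ g in A, ENNReal.ofReal (Real.exp (⟪v, g⟫ + n * (b / 2) * (‖g‖ ^ 2 - 1))) ∂μ +
      ENNReal.ofReal (16 * B * n * w ^ 2) * ∫⁻ g in A, ENNReal.ofReal
        (Real.exp (⟪v, g⟫ + (n * (b / 2) + w⁻¹) * (‖g‖ ^ 2 - 1))) ∂μ +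
      ENNReal.ofReal (16 * B * n * w ^ 2) * ∫⁻ g in A, ENNReal.ofReal
        (Real.exp (⟪v, g⟫ + (n * (b / 2) - w⁻¹) * (‖g‖ ^ 2 - 1))) ∂μ := by
  have hW : 0 ≤ 16 * B * n * w ^ 2 := by positivity
  rw [← lintegral_const_mul _ (by fun_prop), ← lintegral_const_mul _ (by fun_prop),
    ← lintegral_add_right _ (by fun_prop), ← lintegral_add_right _ (by fun_prop)]
  refine setLIntegral_mono' hA fun g hg => ?_
  rw [← ENNReal.ofReal_mul hW, ← ENNReal.ofReal_mul hW,
    ← ENNReal.ofReal_add (by positivity) (by positivity),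
    ← ENNReal.ofReal_add (by positivity) (by positivity)]
  refine ENNReal.ofReal_le_ofReal ?_
  simp only [Real.exp_add ⟪v, g⟫]
  linarith [mul_le_mul_of_nonneg_left (exp_normPotential_le (b := b) hB hw hn (hs g hg))
    (Real.exp_pos ⟪v, g⟫).le]

/-- The constant in the error term of each integration. -/
noncomputable def stepConst (M : ℝ) : ℝ := 123 * M ^ 7 + (3 * M ^ 4 + 32 * M ^ 2 * Real.exp 9)

namespace SmallRegime

variable {M t w η δ β R k n θ : ℝ}

lemma mul_w_le (hr : SmallRegime M t w η δ β R) (hk : k ≤ R) : k * w ≤ M * η :=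
  (mul_le_mul_of_nonneg_right hk hr.w_pos.le).trans hr.R_mul_le

lemma mul_mul_sq_w_le (hr : SmallRegime M t w η δ β R) (hk : k ≤ R) (hn0 : 0 ≤ n) (hn : n ≤ R) :
    k * n * w ^ 2 ≤ R ^ 2 * w * η := by
  have hw := hr.w_pos.le
  have hR := hr.R_nonneg
  calc k * n * w ^ 2 = k * n * w * w := by ring
    _ ≤ R * R * w * η := by
        have := hr.w_le
        gcongr
    _ = R ^ 2 * w * η := by ring

lemma abs_two_mul_mul_sq_le (hr : SmallRegime M t w η δ β R) (hθ : |θ| * w ≤ 2) :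
    |2 * θ * w ^ 2| ≤ 4 * η :=
  calc |2 * θ * w ^ 2| = 2 * (|θ| * w) * w := by
        rw [abs_mul, abs_mul, abs_two, abs_of_nonneg (sq_nonneg w)]
        ring
    _ ≤ 2 * 2 * w := by
        have := hr.w_pos.le
        gcongr
    _ ≤ 4 * η := by linarith [hr.w_le]

lemma abs_mul_w_le_two {ϑ : ℝ} (hr : SmallRegime M t w η δ β R) (hθ : |θ| * w ≤ 1)
    (hϑ : |ϑ| ≤ |θ| + |w⁻¹|) : |ϑ| * w ≤ 2 :=
  calc |ϑ| * w ≤ (|θ| + |w⁻¹|) * w := mul_le_mul_of_nonneg_right hϑ hr.w_pos.le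
    _ = |θ| * w + 1 := by
        rw [abs_of_pos (inv_pos.2 hr.w_pos), add_mul, inv_mul_cancel₀ hr.w_pos.ne']
    _ ≤ 2 := by linarith

lemma tilt_error_le_nine (hr : SmallRegime M t w η δ β R) (hk : k ≤ R) (hθ : |θ| * w ≤ 2) :
    2 * k * M ^ 2 * |2 * θ * w ^ 2| + 2 * θ ^ 2 * w ^ 2 ≤ 9 := by
  have hw := hr.w_pos.le
  have hlinear : 2 * k * M ^ 2 * |2 * θ * w ^ 2| ≤ 1 :=
    calc 2 * k * M ^ 2 * |2 * θ * w ^ 2| = 4 * M ^ 2 * (k * w) * (|θ| * w) := by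
          rw [abs_mul, abs_mul, abs_two, abs_of_nonneg (sq_nonneg w)]
          ring
      _ ≤ 4 * M ^ 2 * (M * η) * 2 := by
          have := hr.mul_w_le hk
          have := mul_nonneg hr.M_nonneg hr.η_nonneg
          gcongr
      _ = 8 * (M ^ 3 * η) := by ring
      _ ≤ 1 := by
          linarith [hr.pow_mul_η_le (m := 3) (by norm_num),
            mul_nonneg (pow_nonneg hr.M_nonneg 3) hr.η_nonneg]
  have hquadratic : 2 * θ ^ 2 * w ^ 2 ≤ 2 * 2 ^ 2 := by
    rw [mul_assoc, ← sq_abs θ, ← mul_pow]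
    gcongr
  linarith

lemma abs_potential_slope_le (hr : SmallRegime M t w η δ β R) (hn0 : 0 ≤ n) :
    |n * (-(gaussHazard t * t) / 2)| ≤ n * M ^ 2 / 2 := by
  rw [abs_mul, abs_div, abs_two, abs_of_nonneg hn0, mul_div_assoc]
  have := hr.abs_hazard_mul_le
  gcongr

lemma abs_potential_slope_mul_w_le (hr : SmallRegime M t w η δ β R) (hn0 : 0 ≤ n) (hn : n ≤ R) :
    |n * (-(gaussHazard t * t) / 2)| * w ≤ 1 :=
  calc |n * (-(gaussHazard t * t) / 2)| * w ≤ n * M ^ 2 / 2 * w :=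
        mul_le_mul_of_nonneg_right (hr.abs_potential_slope_le hn0) hr.w_pos.le
    _ = M ^ 2 / 2 * (n * w) := by ring
    _ ≤ M ^ 2 / 2 * (M * η) := mul_le_mul_of_nonneg_left (hr.mul_w_le hn) (by positivity)
    _ = M ^ 3 * η / 2 := by ring
    _ ≤ 1 := by linarith [hr.pow_mul_η_le (m := 3) (by norm_num)]

lemma potential_slope_error_le (hr : SmallRegime M t w η δ β R) (hk0 : 0 ≤ k) (hk : k ≤ R)
    (hn0 : 0 ≤ n) (hn : n ≤ R) :
    2 * k * M ^ 2 * |2 * (n * (-(gaussHazard t * t) / 2)) * w ^ 2| +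
        2 * (n * (-(gaussHazard t * t) / 2)) ^ 2 * w ^ 2 ≤ 3 * M ^ 4 * (R ^ 2 * w * η) := by
  have hslope := hr.abs_potential_slope_le hn0
  have hlinear : 2 * k * M ^ 2 * |2 * (n * (-(gaussHazard t * t) / 2)) * w ^ 2| ≤
      2 * M ^ 4 * (R ^ 2 * w * η) :=
    calc _ = 4 * k * M ^ 2 * |n * (-(gaussHazard t * t) / 2)| * w ^ 2 := by
          rw [abs_mul, abs_mul 2, abs_two, abs_of_nonneg (sq_nonneg w)]
          ring
      _ ≤ 4 * k * M ^ 2 * (n * M ^ 2 / 2) * w ^ 2 := by gcongr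
      _ = 2 * M ^ 4 * (k * n * w ^ 2) := by ring
      _ ≤ _ := mul_le_mul_of_nonneg_left (hr.mul_mul_sq_w_le hk hn0 hn) (by positivity)
  have hquadratic : 2 * (n * (-(gaussHazard t * t) / 2)) ^ 2 * w ^ 2 ≤
      M ^ 4 / 2 * (R ^ 2 * w * η) :=
    calc _ ≤ 2 * (n * M ^ 2 / 2) ^ 2 * w ^ 2 := by
          rw [← sq_abs (n * _)]
          gcongr
      _ = M ^ 4 / 2 * (n * n * w ^ 2) := by ring
      _ ≤ _ := mul_le_mul_of_nonneg_left (hr.mul_mul_sq_w_le hn hn0 hn) (by positivity)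
  linarith [mul_nonneg (pow_nonneg hr.M_nonneg 4) hr.error_nonneg]

lemma potential_square_le_one (hr : SmallRegime M t w η δ β R) (hn0 : 0 ≤ n) (hn : n ≤ R) {s : ℝ}
    (hs : |s| ≤ δ) : n * (4 * M ^ 2 * s ^ 2) ≤ 1 :=
  calc n * (4 * M ^ 2 * s ^ 2) ≤ n * (4 * M ^ 2 * (9 * M ^ 2 * w)) := by
        have : s ^ 2 ≤ 9 * M ^ 2 * w := (sq_le_sq' (abs_le.1 hs).1 (abs_le.1 hs).2).trans hr.δ_sq_le
        gcongr
    _ = 36 * M ^ 4 * (n * w) := by ring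
    _ ≤ 36 * M ^ 4 * (M * η) := by
        have := hr.mul_w_le hn
        gcongr
    _ = 36 * (M ^ 5 * η) := by ring
    _ ≤ 1 := by
        linarith [hr.pow_mul_η_le (m := 5) (by norm_num),
          mul_nonneg (pow_nonneg hr.M_nonneg 5) hr.η_nonneg]

lemma exp_add_potential_weight_le (hr : SmallRegime M t w η δ β R) (hn0 : 0 ≤ n) (hn : n ≤ R) :
    Real.exp (3 * M ^ 4 * (R ^ 2 * w * η)) + 2 * (16 * M ^ 2 * n * w ^ 2) * Real.exp 9 ≤
      Real.exp ((3 * M ^ 4 + 32 * M ^ 2 * Real.exp 9) * (R ^ 2 * w * η)) := by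
  have hQ := hr.error_nonneg
  have hweight : n * w ^ 2 ≤ R ^ 2 * w * η := by
    simpa using hr.mul_mul_sq_w_le hr.one_le_R hn0 hn
  calc _ ≤ Real.exp (3 * M ^ 4 * (R ^ 2 * w * η)) +
        32 * M ^ 2 * Real.exp 9 * (R ^ 2 * w * η) := by
        have := mul_le_mul_of_nonneg_left hweight (by positivity : 0 ≤ 32 * M ^ 2 * Real.exp 9)
        linarith
    _ ≤ _ := (exp_add_le_exp_add (by positivity) (by positivity)).trans_eq (by rw [add_mul])

lemma sum_exp_add_potential_weight_le {c : ℝ} (hr : SmallRegime M t w η δ β R) (hn0 : 0 ≤ n)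
    (hn : n ≤ R) (hc : 0 ≤ c) (b : ℝ) :
    c * Real.exp (b + 3 * M ^ 4 * (R ^ 2 * w * η)) +
        16 * M ^ 2 * n * w ^ 2 * (c * Real.exp (b + 9)) +
        16 * M ^ 2 * n * w ^ 2 * (c * Real.exp (b + 9)) ≤
      c * Real.exp (b + (3 * M ^ 4 + 32 * M ^ 2 * Real.exp 9) * (R ^ 2 * w * η)) := by
  simp only [Real.exp_add b]
  linarith [mul_le_mul_of_nonneg_left (hr.exp_add_potential_weight_le hn0 hn)
    (mul_nonneg hc (Real.exp_pos b).le)]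

end SmallRegime

namespace GoodSeq

variable {E : Type*} [NormedAddCommGroup E] [InnerProductSpace ℝ E] [FiniteDimensional ℝ E]
  [MeasurableSpace E] [BorelSpace E] {M σ t w η δ β R θ ε : ℝ} {k n : ℕ} {x : Fin k → E}

lemma setLIntegral_exp_tiltCoeff_le (hr : SmallRegime M t w η δ β R) (hx : GoodSeq σ t w δ β x)
    (hσ : |σ| = 1) (hd : (Module.finrank ℝ E : ℝ) * w ^ 2 = 1) (hk : (k : ℝ) ≤ R)
    (hn : (n : ℝ) ≤ R) {A : Set E} (hA : A ⊆ orthant (fun i => σ • x i) fun _ => t * w)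
    (hθ : |θ| * w ≤ 2) (hε : 2 * k * M ^ 2 * |2 * θ * w ^ 2| + 2 * θ ^ 2 * w ^ 2 ≤ ε) :
    ∫⁻ g in A, ENNReal.ofReal
        (Real.exp (⟪tiltCoeff σ t w η n • ∑ i, x i, g⟫ + θ * (‖g‖ ^ 2 - 1)))
        ∂((stdGaussian E).map (w • ·)) ≤
      ENNReal.ofReal (gaussCDF t ^ k * Real.exp (-σ * gaussHazard t ^ 3 * w * (n * k) +
        123 * M ^ 7 * (R ^ 2 * w * η) +
        ∑ i, normPotential (M ^ 2) (-(gaussHazard t * t)) (‖x i‖ ^ 2 - 1) +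
        tiltIncrement σ t w η (tiltCoeff σ t w η n) * pairSum x + ε)) := by
  refine (lintegral_mono_set hA).trans <|
    (hx.setLIntegral_exp_tilt_le hr hσ hk (hr.abs_tiltCoeff_le hσ hn) hd
      (hr.abs_two_mul_mul_sq_le hθ)).trans (ENNReal.ofReal_le_ofReal ?_)
  refine mul_le_mul_of_nonneg_left (Real.exp_le_exp.2 ?_) (pow_nonneg (gaussCDF_pos t).le k)
  linarith [hr.neg_hazard_mul_tiltCoeff_le hσ hn k.cast_nonneg hk,
    hr.pow_mul_error_le (m := 5) (n := 7) (by norm_num)]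

lemma setLIntegral_exp_tiltCoeff_normPotential_le (hr : SmallRegime M t w η δ β R)
    (hx : GoodSeq σ t w δ β x) (hσ : |σ| = 1) (hd : (Module.finrank ℝ E : ℝ) * w ^ 2 = 1)
    (hk : (k : ℝ) ≤ R) (hn : (n : ℝ) ≤ R) :
    ∫⁻ g in orthant (fun i => σ • x i) (fun _ => t * w) ∩ {g | |‖g‖ ^ 2 - 1| ≤ δ},
        ENNReal.ofReal (Real.exp (⟪tiltCoeff σ t w η n • ∑ i, x i, g⟫ +
          n * normPotential (M ^ 2) (-(gaussHazard t * t)) (‖g‖ ^ 2 - 1)))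
        ∂((stdGaussian E).map (w • ·)) ≤
      ENNReal.ofReal (gaussCDF t ^ k * Real.exp (-σ * gaussHazard t ^ 3 * w * (n * k) +
        stepConst M * (R ^ 2 * w * η) +
        ∑ i, normPotential (M ^ 2) (-(gaussHazard t * t)) (‖x i‖ ^ 2 - 1) +
        tiltIncrement σ t w η (tiltCoeff σ t w η n) * pairSum x)) := by
  have hw := hr.w_pos
  have hqk := pow_nonneg (gaussCDF_pos t).le k
  have htilt {ϑ ε : ℝ} :=
    hx.setLIntegral_exp_tiltCoeff_le (θ := ϑ) (ε := ε) hr hσ hd hk hn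
      (Set.inter_subset_left (t := {g | |‖g‖ ^ 2 - 1| ≤ δ}))
  have hslope := hr.abs_potential_slope_mul_w_le n.cast_nonneg hn
  have hplus := hr.abs_mul_w_le_two hslope (abs_add_le _ _)
  have hminus := hr.abs_mul_w_le_two hslope (abs_sub _ _)
  have hwindow : MeasurableSet {g : E | |‖g‖ ^ 2 - 1| ≤ δ} :=
    measurableSet_le (by fun_prop) measurable_const
  refine (setLIntegral_exp_normPotential_le _ ((measurableSet_orthant _ _).inter hwindow) _ _
    (sq_nonneg M) hw n.cast_nonneg
    fun g hg => hr.potential_square_le_one n.cast_nonneg hn hg.2).trans ?_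
  refine (add_le_add (add_le_add
    (htilt (hslope.trans one_le_two)
      (hr.potential_slope_error_le k.cast_nonneg hk n.cast_nonneg hn))
    (mul_le_mul_right (htilt hplus (hr.tilt_error_le_nine hk hplus)) _))
    (mul_le_mul_right (htilt hminus (hr.tilt_error_le_nine hk hminus)) _)).trans ?_
  have hW : 0 ≤ 16 * M ^ 2 * n * w ^ 2 := by positivity
  rw [← ENNReal.ofReal_mul hW, ← ENNReal.ofReal_add (by positivity) (by positivity),
    ← ENNReal.ofReal_add (by positivity) (by positivity)]
  refine ENNReal.ofReal_le_ofReal ?_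
  refine (hr.sum_exp_add_potential_weight_le n.cast_nonneg hn hqk _).trans_eq ?_
  rw [stepConst]
  ring_nf

end GoodSeq

/-! ### Integrating out all vectors -/

section Potential

variable {E : Type*} [NormedAddCommGroup E] [InnerProductSpace ℝ E]

lemma pairSum_snoc {k : ℕ} (x : Fin k → E) (y : E) :
    pairSum (Fin.snoc x y : Fin (k + 1) → E) = pairSum x + ⟪∑ i, x i, y⟫ := by
  simp only [pairSum, Fin.sum_univ_castSucc, Fin.snoc_castSucc, Fin.snoc_last]
  rw [norm_add_sq_real]
  ring

/-- The exponent accumulated on the remaining vectors `x` after `n` vectors have been integrated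
out. -/
noncomputable def seqPotential (M σ t w η : ℝ) (n : ℕ) {k : ℕ} (x : Fin k → E) : ℝ :=
  tiltCoeff σ t w η n * pairSum x +
    n * ∑ i, normPotential (M ^ 2) (-(gaussHazard t * t)) (‖x i‖ ^ 2 - 1)

lemma seqPotential_snoc (M σ t w η : ℝ) (n : ℕ) {k : ℕ} (x : Fin k → E) (y : E) :
    seqPotential M σ t w η n (Fin.snoc x y : Fin (k + 1) → E) = seqPotential M σ t w η n x +
      (⟪tiltCoeff σ t w η n • ∑ i, x i, y⟫ +
        n * normPotential (M ^ 2) (-(gaussHazard t * t)) (‖y‖ ^ 2 - 1)) := by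
  simp only [seqPotential, pairSum_snoc, Fin.sum_univ_castSucc, Fin.snoc_castSucc, Fin.snoc_last,
    real_inner_smul_left]
  ring

end Potential

section Snoc

variable {E : Type*} [MeasurableSpace E] {k : ℕ} {F : (Fin (k + 1) → E) → ENNReal}

lemma lintegral_pi_snoc (ν : Measure E) [SigmaFinite ν] (hF : Measurable F) :
    ∫⁻ x, F x ∂(Measure.pi fun _ => ν) =
      ∫⁻ x, ∫⁻ y, F (Fin.snoc x y) ∂ν ∂(Measure.pi fun _ : Fin k => ν) := by
  have hsplit := (measurePreserving_piFinSuccAbove (fun _ => ν) (Fin.last k)).symm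
  rw [← hsplit.lintegral_comp hF]
  refine (lintegral_prod_symm _ (hF.comp hsplit.measurable).aemeasurable).trans ?_
  exact lintegral_congr fun x => lintegral_congr fun y => congrArg F (Fin.insertNth_last' y x)

lemma setLIntegral_pi_snoc_le (ν : Measure E) [SigmaFinite ν] (hF : Measurable F)
    {S : Set (Fin (k + 1) → E)} (hS : MeasurableSet S) {T : Set (Fin k → E)}
    (hT : MeasurableSet T) {A : (Fin k → E) → Set E} (hA : ∀ x, MeasurableSet (A x))
    (hsub : ∀ x y, Fin.snoc x y ∈ S → x ∈ T ∧ y ∈ A x) :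
    ∫⁻ x in S, F x ∂(Measure.pi fun _ => ν) ≤
      ∫⁻ x in T, ∫⁻ y in A x, F (Fin.snoc x y) ∂ν ∂(Measure.pi fun _ => ν) := by
  rw [← lintegral_indicator hS, lintegral_pi_snoc ν (hF.indicator hS), ← lintegral_indicator hT]
  refine lintegral_mono fun x => ?_
  by_cases hx : x ∈ T
  · rw [Set.indicator_of_mem hx, ← lintegral_indicator (hA x)]
    refine lintegral_mono fun y => Set.indicator_apply_le' (fun hxy => ?_) fun _ => zero_le
    rw [Set.indicator_of_mem (hsub x y hxy).2]
  · refine (lintegral_eq_zero_of_ae_eq_zero (ae_of_all _ fun y => ?_)).trans_le zero_le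
    exact Set.indicator_of_notMem (fun hxy => hx (hsub x y hxy).1) _

end Snoc

lemma norm_starProjection_le_iff {E : Type*} [NormedAddCommGroup E] [InnerProductSpace ℝ E]
    (S : Submodule ℝ E) [S.HasOrthogonalProjection] {x : E} {β : ℝ} (hβ : 0 ≤ β) :
    ‖S.starProjection x‖ ≤ β ↔ ∀ v ∈ S, |⟪x, v⟫| ≤ β * ‖v‖ := by
  have hinner : ∀ v ∈ S, ⟪x, v⟫ = ⟪S.starProjection x, v⟫ := fun v hv => by
    rw [← sub_eq_zero, ← inner_sub_left]
    exact S.starProjection_inner_eq_zero x v hv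
  refine ⟨fun h v hv => ?_, fun h => ?_⟩
  · rw [hinner v hv]
    exact (abs_real_inner_le_norm _ _).trans (mul_le_mul_of_nonneg_right h (norm_nonneg v))
  · have hmem := S.starProjection_apply_mem x
    have hself := h _ hmem
    rw [hinner _ hmem, real_inner_self_eq_norm_mul_norm, abs_mul_self] at hself
    rcases (norm_nonneg (S.starProjection x)).eq_or_lt with hzero | hpos
    · exact hzero ▸ hβ
    · exact le_of_mul_le_mul_right hself hpos

lemma isClosed_setOf_norm_prefixProj_le {E : Type*} [NormedAddCommGroup E] [InnerProductSpace ℝ E]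
    [FiniteDimensional ℝ E] {β : ℝ} (hβ : 0 ≤ β) {k : ℕ} (i : Fin k) :
    IsClosed {x : Fin k → E | ‖prefixProj x i‖ ≤ β} := by
  have hset : {x : Fin k → E | ‖prefixProj x i‖ ≤ β} = ⋂ a : Fin k → ℝ,
      {x | |⟪x i, ∑ j with j < i, a j • x j⟫| ≤ β * ‖∑ j with j < i, a j • x j‖} := by
    ext x
    have himage : x '' {j | j < i} = x '' (Finset.univ.filter (· < i) : Finset (Fin k)) := by
      rw [Finset.coe_filter_univ]
    simp only [Set.mem_iInter, Set.mem_ofPred_eq]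
    rw [prefixProj, norm_starProjection_le_iff _ hβ, himage]
    simp only [Submodule.mem_span_image_finset_iff_exists_fun', forall_exists_index,
      forall_apply_eq_imp_iff]
  rw [hset]
  exact isClosed_iInter fun a => isClosed_le (by fun_prop) (by fun_prop)

namespace GoodSeq

variable {E : Type*} [NormedAddCommGroup E] [InnerProductSpace ℝ E] [FiniteDimensional ℝ E]
  {σ t w δ β : ℝ} {k : ℕ}

lemma of_snoc {x : Fin k → E} {y : E}
    (h : GoodSeq σ t w δ β (Fin.snoc x y : Fin (k + 1) → E)) : GoodSeq σ t w δ β x where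
  clique i j hij := by simpa using h.clique i.castSucc j.castSucc (by simpa using hij)
  norm_window i := by simpa using h.norm_window i.castSucc
  norm_prefixProj_le i := by
    have hproj := h.norm_prefixProj_le i.castSucc
    rwa [← prefixProj_comp_castSucc, Fin.snoc_comp_castSucc] at hproj

lemma mem_orthant_inter_of_snoc {x : Fin k → E} {y : E}
    (h : GoodSeq σ t w δ β (Fin.snoc x y : Fin (k + 1) → E)) :
    y ∈ orthant (fun i => σ • x i) (fun _ => t * w) ∩ {g | |‖g‖ ^ 2 - 1| ≤ δ} := by
  refine ⟨fun i => ?_, by simpa using h.norm_window (Fin.last k)⟩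
  simpa [real_inner_smul_left] using h.clique i.castSucc (Fin.last k) (Fin.castSucc_lt_last i).ne

end GoodSeq

section Induction

variable {E : Type*} [NormedAddCommGroup E] [InnerProductSpace ℝ E] [FiniteDimensional ℝ E]
  {M σ t w η δ β R : ℝ}

lemma isClosed_setOf_goodSeq (σ t w δ : ℝ) (hβ : 0 ≤ β) (k : ℕ) :
    IsClosed {x : Fin k → E | GoodSeq σ t w δ β x} := by
  have hset : {x : Fin k → E | GoodSeq σ t w δ β x} =
      (⋂ i, ⋂ j, ⋂ _ : i ≠ j, {x | σ * ⟪x i, x j⟫ ≤ t * w}) ∩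
      ((⋂ i, {x | |‖x i‖ ^ 2 - 1| ≤ δ}) ∩ ⋂ i, {x | ‖prefixProj x i‖ ≤ β}) := by
    ext x
    simp only [Set.mem_inter_iff, Set.mem_iInter, Set.mem_ofPred_eq]
    exact ⟨fun h => ⟨h.1, h.2, h.3⟩, fun h => ⟨h.1, h.2.1, h.2.2⟩⟩
  rw [hset]
  refine IsClosed.inter ?_ (IsClosed.inter ?_ ?_)
  · exact isClosed_iInter fun i => isClosed_iInter fun j => isClosed_iInter fun _ =>
      isClosed_le (by fun_prop) (by fun_prop)
  · exact isClosed_iInter fun i => isClosed_le (by fun_prop) (by fun_prop)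
  · exact isClosed_iInter fun i => isClosed_setOf_norm_prefixProj_le hβ i

variable [MeasurableSpace E] [BorelSpace E]

lemma measurable_seqPotential (M σ t w η : ℝ) (n k : ℕ) :
    Measurable fun x : Fin k → E => seqPotential M σ t w η n x := by
  unfold seqPotential pairSum normPotential
  fun_prop

lemma GoodSeq.setLIntegral_exp_seqPotential_snoc_le {k n : ℕ} {x : Fin k → E}
    (hr : SmallRegime M t w η δ β R) (hx : GoodSeq σ t w δ β x) (hσ : |σ| = 1)
    (hd : (Module.finrank ℝ E : ℝ) * w ^ 2 = 1) (hk : (k : ℝ) ≤ R) (hn : (n : ℝ) ≤ R) :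
    ∫⁻ y in orthant (fun i => σ • x i) (fun _ => t * w) ∩ {g | |‖g‖ ^ 2 - 1| ≤ δ},
        ENNReal.ofReal (Real.exp
          (seqPotential M σ t w η n (Fin.snoc x y : Fin (k + 1) → E)))
        ∂((stdGaussian E).map (w • ·)) ≤
      ENNReal.ofReal (gaussCDF t ^ k * Real.exp (-σ * gaussHazard t ^ 3 * w * (n * k) +
        stepConst M * (R ^ 2 * w * η))) *
      ENNReal.ofReal (Real.exp (seqPotential M σ t w η (n + 1) x)) := by
  have hq := (gaussCDF_pos t).le
  simp only [seqPotential_snoc, Real.exp_add (seqPotential M σ t w η n x),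
    ENNReal.ofReal_mul (Real.exp_pos _).le]
  rw [lintegral_const_mul' _ _ ENNReal.ofReal_ne_top]
  refine (mul_le_mul_right
    (hx.setLIntegral_exp_tiltCoeff_normPotential_le hr hσ hd hk hn) _).trans_eq ?_
  rw [← ENNReal.ofReal_mul (by positivity), ← ENNReal.ofReal_mul (by positivity),
    mul_left_comm, mul_assoc (_ ^ k), ← Real.exp_add, ← Real.exp_add]
  congr 3
  simp only [seqPotential, tiltCoeff]
  push_cast
  ring

lemma setLIntegral_exp_seqPotential_le (hr : SmallRegime M t w η δ β R) (hσ : |σ| = 1)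
    (hd : (Module.finrank ℝ E : ℝ) * w ^ 2 = 1) (k n : ℕ) (hkn : (k : ℝ) + n ≤ R) :
    ∫⁻ x in {x : Fin k → E | GoodSeq σ t w δ β x},
        ENNReal.ofReal (Real.exp (seqPotential M σ t w η n x))
        ∂(Measure.pi fun _ => (stdGaussian E).map (w • ·)) ≤
      ENNReal.ofReal (gaussCDF t ^ k.choose 2 * Real.exp
        (-σ * gaussHazard t ^ 3 * w * (k.choose 3 + n * k.choose 2) +
          k * (stepConst M * (R ^ 2 * w * η)))) := by
  have : IsProbabilityMeasure ((stdGaussian E).map (w • ·)) :=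
    Measure.isProbabilityMeasure_map (by fun_prop)
  have hq := (gaussCDF_pos t).le
  induction k generalizing n with
  | zero =>
    refine (setLIntegral_le_lintegral _ _).trans ?_
    simp [seqPotential, pairSum]
  | succ k ih =>
    push_cast at hkn
    have hwindow : MeasurableSet {g : E | |‖g‖ ^ 2 - 1| ≤ δ} :=
      measurableSet_le (by fun_prop) measurable_const
    have hclosed (k : ℕ) := isClosed_setOf_goodSeq (E := E) σ t w δ hr.β_nonneg k
    have hpotential := measurable_seqPotential (E := E) M σ t w η n (k + 1)
    refine (setLIntegral_pi_snoc_le _ hpotential.exp.ennreal_ofReal (hclosed _).measurableSet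
      (hclosed k).measurableSet (fun x => (measurableSet_orthant _ _).inter hwindow)
      fun x y h => ⟨h.of_snoc, h.mem_orthant_inter_of_snoc⟩).trans ?_
    refine (setLIntegral_mono' (hclosed k).measurableSet fun x hx =>
      GoodSeq.setLIntegral_exp_seqPotential_snoc_le hr hx hσ hd
        (by linarith [n.cast_nonneg (α := ℝ)]) (by linarith [k.cast_nonneg (α := ℝ)])).trans ?_
    rw [lintegral_const_mul' _ _ ENNReal.ofReal_ne_top]
    refine (mul_le_mul_right (ih (n + 1) (by push_cast; linarith)) _).trans_eq ?_
    rw [← ENNReal.ofReal_mul (by positivity), mul_mul_mul_comm, ← Real.exp_add, ← pow_add,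
      Nat.choose_succ_succ' k 1, Nat.choose_succ_succ' k 2, Nat.choose_one_right]
    congr 3
    push_cast
    ring

lemma measure_goodSeq_le {r : ℕ} (hr : SmallRegime M t w η δ β r) (hσ : |σ| = 1)
    (hd : (Module.finrank ℝ E : ℝ) * w ^ 2 = 1) :
    (Measure.pi fun _ : Fin r => (stdGaussian E).map (w • ·)) {x | GoodSeq σ t w δ β x} ≤
      ENNReal.ofReal (gaussCDF t ^ r.choose 2 * Real.exp
        (-σ * gaussHazard t ^ 3 * w * r.choose 3 + stepConst M * (r ^ 3 * w * η))) := by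
  have hmain := setLIntegral_exp_seqPotential_le (E := E) hr hσ hd r 0 (by simp)
  simp only [seqPotential, tiltCoeff, zero_mul, Nat.cast_zero, add_zero, Real.exp_zero,
    ENNReal.ofReal_one, setLIntegral_one] at hmain
  refine hmain.trans_eq ?_
  ring_nf

end Induction

/-! ### Monochromatic perfect sequences -/

lemma gaussCDF_neg (t : ℝ) : gaussCDF (-t) = 1 - gaussCDF t := by
  have : NullSingletonClass (gaussianReal 0 1) := nullSingletonClass_gaussianReal one_ne_zero
  have hsymm : (gaussianReal 0 1).map (fun x => -x) = gaussianReal 0 1 := by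
    simpa using gaussianReal_map_neg (μ := 0) (v := 1)
  have hpreimage : (fun x : ℝ => -x) ⁻¹' Set.Iic (-t) = Set.Ici t := by
    ext x
    simp
  rw [gaussCDF, gaussCDF, ← probReal_compl_eq_one_sub measurableSet_Iic, Set.compl_Iic,
    measureReal_congr Ioi_ae_eq_Ici, ← hpreimage,
    ← map_measureReal_apply measurable_neg measurableSet_Iic, hsymm]

lemma gaussianPDFReal_gaussThreshold (p : ℝ) :
    gaussianPDFReal 0 1 (gaussThreshold p) = gaussDensityAtThreshold p := by
  rw [gaussianPDFReal_def, gaussDensityAtThreshold]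
  simp only [NNReal.coe_one, mul_one, sub_zero]
  ring

lemma gaussianPDFReal_zero_neg (v : NNReal) (x : ℝ) :
    gaussianPDFReal 0 v (-x) = gaussianPDFReal 0 v x := by
  simp [gaussianPDFReal_def]

section Threshold

variable {p : ℝ}

lemma gaussCDF_neg_gaussThreshold (hp0 : 0 < p) (hp1 : p < 1) :
    gaussCDF (-gaussThreshold p) = p :=
  gaussThreshold_spec hp0 hp1

lemma gaussCDF_gaussThreshold (hp0 : 0 < p) (hp1 : p < 1) :
    gaussCDF (gaussThreshold p) = 1 - p := by
  rw [← neg_neg (gaussThreshold p), gaussCDF_neg, gaussCDF_neg_gaussThreshold hp0 hp1]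

lemma gaussHazard_neg_gaussThreshold (hp0 : 0 < p) (hp1 : p < 1) :
    gaussHazard (-gaussThreshold p) = gaussDensityAtThreshold p / p := by
  rw [gaussHazard, gaussCDF_neg_gaussThreshold hp0 hp1, gaussianPDFReal_zero_neg,
    gaussianPDFReal_gaussThreshold]

lemma gaussHazard_gaussThreshold (hp0 : 0 < p) (hp1 : p < 1) :
    gaussHazard (gaussThreshold p) = gaussDensityAtThreshold p / (1 - p) := by
  rw [gaussHazard, gaussCDF_gaussThreshold hp0 hp1, gaussianPDFReal_gaussThreshold]

end Threshold

lemma multivariateGaussian_zero_smul_one {ι : Type*} [Fintype ι] [DecidableEq ι] {v : ℝ}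
    (hv : 0 ≤ v) :
    multivariateGaussian (0 : EuclideanSpace ℝ ι) (v • (1 : Matrix ι ι ℝ)) =
      (stdGaussian (EuclideanSpace ℝ ι)).map (√v • ·) := by
  have hpsd : (v • (1 : Matrix ι ι ℝ)).PosSemidef := Matrix.PosSemidef.one.smul hv
  have : IsProbabilityMeasure ((stdGaussian (EuclideanSpace ℝ ι)).map (√v • ·)) :=
    Measure.isProbabilityMeasure_map (by fun_prop)
  refine Measure.ext_of_charFun (funext fun y => ?_)
  have hvariance : ‖√v • y‖ ^ 2 = y.ofLp ⬝ᵥ (v • (1 : Matrix ι ι ℝ)).mulVec y := by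
    rw [norm_smul, mul_pow, Real.norm_eq_abs, sq_abs, Real.sq_sqrt hv,
      EuclideanSpace.real_norm_sq_eq, Matrix.smul_mulVec, Matrix.one_mulVec, dotProduct_smul,
      smul_eq_mul]
    simp only [dotProduct, sq]
  rw [charFun_multivariateGaussian hpsd, charFun_map_smul, charFun_stdGaussian, ← hvariance]
  congr 1
  push_cast
  simp only [inner_zero_right, Complex.ofReal_zero, zero_mul, zero_sub, neg_div]

instance isProbabilityMeasure_gaussSample (d r : ℕ) : IsProbabilityMeasure (gaussSample d r) := by
  unfold gaussSample
  infer_instance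

lemma gaussSample_eq (d r : ℕ) : gaussSample d r = Measure.pi fun _ =>
    (stdGaussian (EuclideanSpace ℝ (Fin d))).map ((√(d : ℝ))⁻¹ • ·) := by
  rw [gaussSample, multivariateGaussian_zero_smul_one (by positivity), one_div, Real.sqrt_inv]

lemma perfectDelta_eq (C p : ℝ) (d : ℕ) :
    perfectDelta C p d = perfectAlpha C p * √(√(d : ℝ))⁻¹ := by
  rw [perfectDelta, Real.sqrt_eq_rpow, Real.sqrt_eq_rpow, ← Real.rpow_neg d.cast_nonneg,
    ← Real.rpow_mul d.cast_nonneg]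
  norm_num

lemma abs_sq_sub_one_le {a ε : ℝ} (ha : |a - 1| ≤ ε) (hε : ε ≤ 1) : |a ^ 2 - 1| ≤ 3 * ε := by
  have hsum : |a + 1| ≤ 3 := by
    rw [abs_le] at ha ⊢
    constructor <;> linarith
  calc |a ^ 2 - 1| = |a + 1| * |a - 1| := by
        rw [← abs_mul]
        ring_nf
    _ ≤ 3 * ε := mul_le_mul hsum ha (abs_nonneg _) zero_le_three

lemma IsPerfectSeq.goodSeq {C p σ t M : ℝ} {ℓ d r : ℕ} {x : Fin r → EuclideanSpace ℝ (Fin d)}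
    (hx : IsPerfectSeq C p ℓ x) (hα : |perfectAlpha C p| ≤ M) (hM : M * √(√(d : ℝ))⁻¹ ≤ 1)
    (hclique : ∀ i j, i ≠ j → σ * ⟪x i, x j⟫ ≤ t / √(d : ℝ)) :
    GoodSeq σ t (√(d : ℝ))⁻¹ (3 * (M * √(√(d : ℝ))⁻¹)) (|perfectAlpha C p| * √(ℓ : ℝ) / √(d : ℝ))
      x where
  clique := hclique
  norm_window i := by
    have hδ : perfectDelta C p d ≤ M * √(√(d : ℝ))⁻¹ := by
      rw [perfectDelta_eq]
      exact mul_le_mul_of_nonneg_right ((le_abs_self _).trans hα) (Real.sqrt_nonneg _)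
    obtain ⟨hlower, hupper⟩ := (hx i).1
    exact abs_sq_sub_one_le (abs_le.2 ⟨by linarith, by linarith⟩) hM
  norm_prefixProj_le i := (hx i).2.trans (by gcongr; exact le_abs_self _)

lemma smallRegime_of_scale {M t C α D ℓ R s : ℝ} (hM : 1 ≤ M) (hh : gaussHazard t ≤ M)
    (ht : |t| ≤ M) (hC : C ≤ M) (hα : |α| ≤ M) (hD : 100 * M ^ 6 ≤ D) (hℓ : 9 * M ^ 2 * D ≤ ℓ)
    (hs : s = D * ℓ) (hR : 1 ≤ R) (hRC : R ≤ C * ℓ) :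
    SmallRegime M t s⁻¹ D⁻¹ (3 * (M * √s⁻¹)) (|α| * √ℓ / s) R := by
  have hM2 : 1 ≤ M ^ 2 := one_le_pow₀ hM
  have hM6 : 1 ≤ M ^ 6 := one_le_pow₀ hM
  have hD1 : 1 ≤ D := by linarith
  have hDℓ : D ≤ ℓ := le_trans (le_mul_of_one_le_left (by positivity) (by linarith)) hℓ
  have hℓ1 : 1 ≤ ℓ := hD1.trans hDℓ
  have hδ_sq : (3 * (M * √s⁻¹)) ^ 2 = 9 * M ^ 2 * s⁻¹ := by
    rw [mul_pow, mul_pow, Real.sq_sqrt (by rw [hs]; positivity)]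
    ring
  subst hs
  refine ⟨hM, hh, ht, by positivity, ?_, by positivity, ?_, hδ_sq.le, ?_, hR, ?_, by positivity, ?_⟩
  · exact inv_anti₀ (by positivity) (le_mul_of_one_le_right (by positivity) hℓ1)
  · refine le_of_sq_le_sq ?_ (by positivity)
    rw [hδ_sq]
    calc 9 * M ^ 2 * (D * ℓ)⁻¹ = 9 * M ^ 2 * D / ℓ * D⁻¹ ^ 2 := by field_simp
      _ ≤ 1 * D⁻¹ ^ 2 := by
          gcongr
          exact (div_le_one (by positivity)).2 hℓ
      _ = D⁻¹ ^ 2 := one_mul _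
  · rwa [inv_mul_le_iff₀ (by positivity), mul_one]
  · calc R * (D * ℓ)⁻¹ ≤ M * ℓ * (D * ℓ)⁻¹ := by
          have := hRC.trans (mul_le_mul_of_nonneg_right hC (by positivity))
          gcongr
      _ = M * D⁻¹ := by field_simp
  · calc (|α| * √ℓ / (D * ℓ)) ^ 2 = |α| ^ 2 * D⁻¹ * (D * ℓ)⁻¹ := by
          rw [div_pow, mul_pow, Real.sq_sqrt (by positivity)]
          field_simp
      _ ≤ M ^ 2 * D⁻¹ * (D * ℓ)⁻¹ := by gcongr

/-- The probability that `r` random vectors form a perfect sequence and a clique of the colour with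
sign `σ` and threshold `t`: red is `σ = 1`, `t = -gaussThreshold p`, and blue, up to boundary ties,
is `σ = -1`, `t = gaussThreshold p`. -/
noncomputable def monoPerfectProb (C p σ t : ℝ) (ℓ d r : ℕ) : ℝ :=
  (gaussSample d r).real {x | (∀ i j, i ≠ j → σ * ⟪x i, x j⟫ ≤ t / √(d : ℝ)) ∧ IsPerfectSeq C p ℓ x}

lemma monoPerfectProb_le_one (C p σ t : ℝ) (ℓ d r : ℕ) : monoPerfectProb C p σ t ℓ d r ≤ 1 :=
  measureReal_le_one

lemma redPerfectProb_le_monoPerfectProb (C p : ℝ) (ℓ d r : ℕ) :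
    redPerfectProb C p ℓ d r ≤ monoPerfectProb C p 1 (-gaussThreshold p) ℓ d r := by
  refine measureReal_mono fun x hx => ⟨fun i j hij => ?_, hx.2⟩
  rw [one_mul]
  exact (not_le.1 fun h => hx.1 (Set.mem_univ i) (Set.mem_univ j) hij ⟨hij, h⟩).le

lemma bluePerfectProb_le_monoPerfectProb (C p : ℝ) (ℓ d r : ℕ) :
    bluePerfectProb C p ℓ d r ≤ monoPerfectProb C p (-1) (gaussThreshold p) ℓ d r := by
  refine measureReal_mono fun x hx => ⟨fun i j hij => ?_, hx.2⟩
  have hadj : -gaussThreshold p / √(d : ℝ) ≤ ⟪x i, x j⟫ :=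
    (hx.1 (Set.mem_univ i) (Set.mem_univ j) hij).2
  rw [neg_div] at hadj
  linarith

lemma monoPerfectProb_le {C p σ t M D : ℝ} {ℓ d r : ℕ} (hσ : |σ| = 1)
    (hα : |perfectAlpha C p| ≤ M) (hd : 0 < d)
    (hr : SmallRegime M t (√(d : ℝ))⁻¹ D⁻¹ (3 * (M * √(√(d : ℝ))⁻¹))
      (|perfectAlpha C p| * √(ℓ : ℝ) / √(d : ℝ)) r) :
    monoPerfectProb C p σ t ℓ d r ≤
      gaussCDF t ^ r.choose 2 * Real.exp (-σ * (gaussHazard t ^ 3 / √(d : ℝ)) * r.choose 3 +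
        stepConst M * (r ^ 3 / (D * √(d : ℝ)))) := by
  have hdim : (Module.finrank ℝ (EuclideanSpace ℝ (Fin d)) : ℝ) * (√(d : ℝ))⁻¹ ^ 2 = 1 := by
    rw [finrank_euclideanSpace_fin, inv_pow, Real.sq_sqrt d.cast_nonneg, mul_inv_cancel₀]
    exact Nat.cast_ne_zero.2 hd.ne'
  have hwindow : M * √(√(d : ℝ))⁻¹ ≤ 1 := by linarith [hr.δ_le, hr.η_le_hundredth]
  have hq := (gaussCDF_pos t).le
  rw [monoPerfectProb, gaussSample_eq]
  refine ENNReal.toReal_le_of_le_ofReal (by positivity) ((measure_mono fun x hx =>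
    hx.2.goodSeq hα hwindow hx.1).trans ((measure_goodSeq_le hr hσ hdim).trans_eq ?_))
  congr 3
  rw [div_eq_mul_inv, div_eq_mul_inv, mul_inv]
  ring

/-- `P D ℓ d r` holds uniformly in the asymptotic regime of the theorem: `D` is large, `ℓ` is large
in terms of `D`, and then `d = D² ℓ²` and `1 ≤ r ≤ C ℓ`. -/
def ForLargeScale (C : ℝ) (P : ℝ → ℕ → ℕ → ℕ → Prop) : Prop :=
  ∃ D₀ : ℝ, 0 < D₀ ∧ ∀ D : ℝ, D₀ ≤ D → ∃ ℓ₀ : ℕ, ∀ ℓ : ℕ, ℓ₀ ≤ ℓ →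
    ∀ d : ℕ, (d : ℝ) = D ^ 2 * (ℓ : ℝ) ^ 2 → ∀ r : ℕ, 1 ≤ r → (r : ℝ) ≤ C * (ℓ : ℝ) → P D ℓ d r

namespace ForLargeScale

variable {C : ℝ} {P Q : ℝ → ℕ → ℕ → ℕ → Prop}

lemma and (hP : ForLargeScale C P) (hQ : ForLargeScale C Q) :
    ForLargeScale C fun D ℓ d r => P D ℓ d r ∧ Q D ℓ d r := by
  obtain ⟨D₁, hD₁, hP⟩ := hP
  obtain ⟨D₂, -, hQ⟩ := hQ
  refine ⟨max D₁ D₂, lt_max_of_lt_left hD₁, fun D hD => ?_⟩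
  obtain ⟨ℓ₁, hP⟩ := hP D (le_of_max_le_left hD)
  obtain ⟨ℓ₂, hQ⟩ := hQ D (le_of_max_le_right hD)
  exact ⟨max ℓ₁ ℓ₂, fun ℓ hℓ d hd r hr hrC =>
    ⟨hP ℓ (le_of_max_le_left hℓ) d hd r hr hrC, hQ ℓ (le_of_max_le_right hℓ) d hd r hr hrC⟩⟩

lemma mono (hP : ForLargeScale C P)
    (h : ∀ D ℓ d r, 0 < D → 0 < d → 1 ≤ r → P D ℓ d r → Q D ℓ d r) : ForLargeScale C Q := by
  obtain ⟨D₀, hD₀, hP⟩ := hP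
  refine ⟨D₀, hD₀, fun D hD => ?_⟩
  obtain ⟨ℓ₀, hP⟩ := hP D hD
  refine ⟨ℓ₀, fun ℓ hℓ d hd r hr hrC => h D ℓ d r (hD₀.trans_le hD) ?_ hr (hP ℓ hℓ d hd r hr hrC)⟩
  have hℓ_ne : (ℓ : ℝ) ≠ 0 := fun hℓ_zero => by
    rw [hℓ_zero, mul_zero] at hrC
    have : (1 : ℝ) ≤ r := Nat.one_le_cast.2 hr
    linarith
  have hD_pos : 0 < D := hD₀.trans_le hD
  have : 0 < (d : ℝ) := by
    rw [hd]
    positivity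
  exact_mod_cast this

end ForLargeScale

lemma cube_le_choose_three {r : ℕ} (hr : 3 ≤ r) : (r : ℝ) ^ 3 ≤ 162 * r.choose 3 := by
  have hr_le : r ≤ 3 * (r + 1 - 3) := by omega
  have hchoose : ((r + 1 - 3 : ℕ) : ℝ) ^ 3 ≤ 6 * r.choose 3 := by
    exact_mod_cast
      (r.pow_sub_le_descFactorial 3).trans_eq (Nat.descFactorial_eq_factorial_mul_choose r 3)
  calc (r : ℝ) ^ 3 ≤ ((3 * (r + 1 - 3) : ℕ) : ℝ) ^ 3 := by gcongr
    _ = 27 * ((r + 1 - 3 : ℕ) : ℝ) ^ 3 := by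
        rw [Nat.cast_mul, mul_pow]
        norm_num
    _ ≤ 162 * r.choose 3 := by linarith

lemma exists_forLargeScale_monoPerfectProb_le_add_error (C p t : ℝ) {σ : ℝ} (hσ : |σ| = 1) :
    ∃ K : ℝ, 0 < K ∧ ForLargeScale C fun D ℓ d r =>
      monoPerfectProb C p σ t ℓ d r ≤ gaussCDF t ^ r.choose 2 *
        Real.exp (-σ * (gaussHazard t ^ 3 / √(d : ℝ)) * r.choose 3 +
          K * (r ^ 3 / (D * √(d : ℝ)))) := by
  have hh : 0 ≤ gaussHazard t := gaussHazard_nonneg t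
  have ht := abs_nonneg t
  have hC := abs_nonneg C
  have hα := abs_nonneg (perfectAlpha C p)
  obtain ⟨M, hM⟩ : ∃ M, M = 1 + gaussHazard t + |t| + |C| + |perfectAlpha C p| := ⟨_, rfl⟩
  have hM_ge : 1 ≤ M := by linarith
  refine ⟨stepConst M, by unfold stepConst; positivity, 100 * M ^ 6, by positivity,
    fun D hD => ⟨⌈9 * M ^ 2 * D⌉₊, fun ℓ hℓ d hd r hr hrC => ?_⟩⟩
  have hD_pos : 0 < D := lt_of_lt_of_le (by positivity) hD
  have hℓ_ge : 9 * M ^ 2 * D ≤ ℓ := Nat.ceil_le.1 hℓ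
  have hsqrt : √(d : ℝ) = D * ℓ := by
    rw [hd, ← mul_pow, Real.sqrt_sq (by positivity)]
  have hd_pos : 0 < (d : ℝ) := by
    have : (0 : ℝ) < ℓ := lt_of_lt_of_le (by positivity) hℓ_ge
    rw [hd]
    positivity
  exact monoPerfectProb_le hσ (by linarith) (Nat.cast_pos.1 hd_pos)
    (smallRegime_of_scale hM_ge (by linarith) (by linarith) (by linarith [le_abs_self C])
      (by linarith) hD hℓ_ge hsqrt (Nat.one_le_cast.2 hr) hrC)

lemma exists_forLargeScale_monoPerfectProb_le (C p t : ℝ) {σ : ℝ} (hσ : |σ| = 1) :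
    ∃ K₀ : ℝ, 0 < K₀ ∧ ∀ K, K₀ ≤ K → ForLargeScale C fun D ℓ d r =>
      (r ≠ 2 → monoPerfectProb C p σ t ℓ d r ≤ gaussCDF t ^ r.choose 2 *
        Real.exp ((K / D - σ) * (gaussHazard t ^ 3 / √(d : ℝ)) * r.choose 3)) ∧
      (r = 2 → monoPerfectProb C p σ t ℓ d r ≤ gaussCDF t * Real.exp (K / (D * √(d : ℝ)))) := by
  obtain ⟨k, hk, hlarge⟩ := exists_forLargeScale_monoPerfectProb_le_add_error C p t hσ
  have hh : 0 < gaussHazard t := gaussHazard_pos t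
  have hq : 0 ≤ gaussCDF t := (gaussCDF_pos t).le
  refine ⟨8 * k + 162 * (k / gaussHazard t ^ 3), by positivity, fun K hK =>
    hlarge.mono fun D ℓ d r hD hd hr hle => ⟨fun hr2 => ?_, ?_⟩⟩
  · obtain rfl | hr3 : r = 1 ∨ 3 ≤ r := by omega
    · simpa [Nat.choose_eq_zero_of_lt] using monoPerfectProb_le_one C p σ t ℓ d 1
    · have herror : k * (r ^ 3 / (D * √(d : ℝ))) ≤
          K / D * (gaussHazard t ^ 3 / √(d : ℝ)) * r.choose 3 :=
        calc k * (r ^ 3 / (D * √(d : ℝ)))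
            ≤ k * (162 * r.choose 3 / (D * √(d : ℝ))) := by
              gcongr
              exact cube_le_choose_three hr3
          _ = 162 * (k / gaussHazard t ^ 3) / D * (gaussHazard t ^ 3 / √(d : ℝ)) * r.choose 3 := by
              field_simp
          _ ≤ K / D * (gaussHazard t ^ 3 / √(d : ℝ)) * r.choose 3 := by
              gcongr
              linarith
      refine hle.trans ?_
      gcongr
      linarith
  · rintro rfl
    have hK_ge : k * 8 ≤ K := by
      have : 0 < k / gaussHazard t ^ 3 := by positivity
      linarith
    calc monoPerfectProb C p σ t ℓ d 2
        ≤ gaussCDF t * Real.exp (k * 8 / (D * √(d : ℝ))) := by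
          refine hle.trans_eq ?_
          norm_num [Nat.choose_eq_zero_of_lt, mul_div_assoc]
      _ ≤ gaussCDF t * Real.exp (K / (D * √(d : ℝ))) := by gcongr

lemma exists_forLargeScale_redPerfectProb_le (C : ℝ) {p : ℝ} (hp0 : 0 < p) (hp1 : p < 1) :
    ∃ K₀ : ℝ, 0 < K₀ ∧ ∀ K, K₀ ≤ K → ForLargeScale C fun D ℓ d r =>
      (r ≠ 2 → redPerfectProb C p ℓ d r ≤ p ^ r.choose 2 *
        Real.exp (-((1 - K / D) *
          (gaussDensityAtThreshold p ^ 3 / (p ^ 3 * √(d : ℝ))) * r.choose 3))) ∧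
      (r = 2 → redPerfectProb C p ℓ d r ≤ p * Real.exp (K / (D * √(d : ℝ)))) := by
  obtain ⟨K₀, hK₀, hlarge⟩ :=
    exists_forLargeScale_monoPerfectProb_le C p (-gaussThreshold p) (abs_one (α := ℝ))
  simp only [gaussCDF_neg_gaussThreshold hp0 hp1, gaussHazard_neg_gaussThreshold hp0 hp1, div_pow,
    div_div] at hlarge
  refine ⟨K₀, hK₀, fun K hK => (hlarge K hK).mono fun D ℓ d r _ _ _ h => ?_⟩
  have hred := redPerfectProb_le_monoPerfectProb C p ℓ d r
  refine ⟨fun hr => (hred.trans (h.1 hr)).trans_eq ?_, fun hr => hred.trans (h.2 hr)⟩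
  congr 2
  ring

lemma exists_forLargeScale_bluePerfectProb_le (C : ℝ) {p : ℝ} (hp0 : 0 < p) (hp1 : p < 1) :
    ∃ K₀ : ℝ, 0 < K₀ ∧ ∀ K, K₀ ≤ K → ForLargeScale C fun D ℓ d r =>
      (r ≠ 2 → bluePerfectProb C p ℓ d r ≤ (1 - p) ^ r.choose 2 *
        Real.exp ((1 + K / D) *
          (gaussDensityAtThreshold p ^ 3 / ((1 - p) ^ 3 * √(d : ℝ))) * r.choose 3)) ∧
      (r = 2 → bluePerfectProb C p ℓ d r ≤ (1 - p) * Real.exp (K / (D * √(d : ℝ)))) := by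
  obtain ⟨K₀, hK₀, hlarge⟩ :=
    exists_forLargeScale_monoPerfectProb_le C p (gaussThreshold p) (σ := -1) (by simp)
  simp only [gaussCDF_gaussThreshold hp0 hp1, gaussHazard_gaussThreshold hp0 hp1, div_pow, div_div,
    sub_neg_eq_add, add_comm _ (1 : ℝ)] at hlarge
  refine ⟨K₀, hK₀, fun K hK => (hlarge K hK).mono fun D ℓ d r _ _ _ h => ?_⟩
  have hblue := bluePerfectProb_le_monoPerfectProb C p ℓ d r
  exact ⟨fun hr => hblue.trans (h.1 hr), fun hr => hblue.trans (h.2 hr)⟩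

theorem proposition4_general (C p : ℝ) (hp0 : 0 < p) (hp1 : p < 1) :
    ∃ K : ℝ, 0 < K ∧ ∃ D₀ : ℝ, 0 < D₀ ∧ ∀ D : ℝ, D₀ ≤ D → ∃ ℓ₀ : ℕ, ∀ ℓ : ℕ, ℓ₀ ≤ ℓ →
      ∀ d : ℕ, (d : ℝ) = D ^ 2 * (ℓ : ℝ) ^ 2 → ∀ r : ℕ, 1 ≤ r → (r : ℝ) ≤ C * (ℓ : ℝ) →
        (r ≠ 2 →
          redPerfectProb C p ℓ d r ≤
            p ^ (r.choose 2) *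
              Real.exp (-((1 - K / D) *
                (gaussDensityAtThreshold p ^ 3 / (p ^ 3 * √(d : ℝ))) * (r.choose 3 : ℝ))) ∧
          bluePerfectProb C p ℓ d r ≤
            (1 - p) ^ (r.choose 2) *
              Real.exp ((1 + K / D) *
                (gaussDensityAtThreshold p ^ 3 / ((1 - p) ^ 3 * √(d : ℝ))) * (r.choose 3 : ℝ))) ∧
        (r = 2 →
          redPerfectProb C p ℓ d r ≤ p * Real.exp (K / (D * √(d : ℝ))) ∧
          bluePerfectProb C p ℓ d r ≤ (1 - p) * Real.exp (K / (D * √(d : ℝ)))) := by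
  obtain ⟨K₁, hK₁, hred⟩ := exists_forLargeScale_redPerfectProb_le C hp0 hp1
  obtain ⟨K₂, -, hblue⟩ := exists_forLargeScale_bluePerfectProb_le C hp0 hp1
  exact ⟨max K₁ K₂, lt_max_of_lt_left hK₁,
    ((hred _ (le_max_left K₁ K₂)).and (hblue _ (le_max_right K₁ K₂))).mono
      fun _ _ _ _ _ _ _ h => ⟨fun hr => ⟨h.1.1 hr, h.2.1 hr⟩, fun hr => ⟨h.1.2 hr, h.2.2 hr⟩⟩⟩

theorem proposition4 (C p : ℝ) (hC : 1 < C) (hp0 : 0 < p) (hp1 : p < 1) :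
    ∃ K : ℝ, 0 < K ∧ ∃ D₀ : ℝ, 0 < D₀ ∧ ∀ D : ℝ, D₀ ≤ D → ∃ ℓ₀ : ℕ, ∀ ℓ : ℕ, ℓ₀ ≤ ℓ →
      ∀ d : ℕ, (d : ℝ) = D ^ 2 * (ℓ : ℝ) ^ 2 → ∀ r : ℕ, 1 ≤ r → (r : ℝ) ≤ C * (ℓ : ℝ) →
        (r ≠ 2 →
          redPerfectProb C p ℓ d r ≤
            p ^ (r.choose 2) *
              Real.exp (-((1 - K / D) *
                (gaussDensityAtThreshold p ^ 3 / (p ^ 3 * √(d : ℝ))) * (r.choose 3 : ℝ))) ∧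
          bluePerfectProb C p ℓ d r ≤
            (1 - p) ^ (r.choose 2) *
              Real.exp ((1 + K / D) *
                (gaussDensityAtThreshold p ^ 3 / ((1 - p) ^ 3 * √(d : ℝ))) * (r.choose 3 : ℝ))) ∧
        (r = 2 →
          redPerfectProb C p ℓ d r ≤ p * Real.exp (K / (D * √(d : ℝ))) ∧
          bluePerfectProb C p ℓ d r ≤ (1 - p) * Real.exp (K / (D * √(d : ℝ)))) :=
  proposition4_general C p hp0 hp1
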